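/- Identify the plane $\mathbb{R}^2$ with $\mathbb{C}$. Let $T_1,\dots,T_m\subset\mathbb{C}$ be compact sets with nonempty interior (prototiles), and for $1\le i,j\le m$ let $\Phi_{ij}$ be a finite set of Euclidean motions (reflections allowed). A \emph{tile} is a marked copy $T=g(T_i)$ of a prototile, given by its type $i$ and a motion $g$; if $g(z)=e^{i\alpha}z+t$ or $g(z)=e^{i\alpha}\bar z+t$ with $\alpha\in[0,2\pi)$, its orientation is $\alpha(T)=\alpha$. Put $\sigma(T_i)=\{\varphi(T_j) : 1\le j\le m,\ \varphi\in\Phi_{ij}\}$, and suppose that $\sigma$ is \emph{self-similar}: there is $\lambda>1$ such that, for each $i$, the union of the tiles in $\sigma(T_i)$ is $\lambda T_i$ and distinct tiles in $\sigma(T_i)$ have disjoint interiors. For a tile $T=A\,T_i+t$ with $A$ linear, put $\sigma(T)=\{A\,\varphi(T_j)+\lambda t : 1\le j\le m,\ \varphi\in\Phi_{ij}\}$, and extend $\sigma$ to collections of tiles by taking unions. Suppose that $\sigma$ is \emph{primitive}: some power $S^k$, $k\ge1$, of the matrix $S=(|\Phi_{ij}|)_{i,j}$ has only positive entries. Let $X_\sigma$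 be the set of all tilings $\mathcal{T}$ of the plane (collections of tiles that cover the plane and have pairwise disjoint interiors) such that each finite subset of $\mathcal{T}$ is congruent to a subset of some $\sigma^n(T_i)$. A tiling $\mathcal{T}\in X_\sigma$ is \emph{pinwheel-like} if $\{\alpha(T):T\in\mathcal{T}\}$ is infinite. It has \emph{statistical circular symmetry} if the following two conditions hold for all $0\le x<y<2\pi$. (a) Let $(\tau_j)_{j\ge1}$ be any enumeration without repetition of the tiles of $\mathcal{T}$ for which the set $N$ of all $n$ such that $\{\tau_1,\dots,\tau_n\}$ is congruent to some supertile $\sigma^k(T_i)$ is infinite. Then $$\lim_{n\to\infty,\ n\in N}\ \frac1n\,\bigl|\{\,1\le j\le n : \alpha(\tau_j)\in[x,y]\,\}\bigr|=\frac{y-x}{2\pi}.$$ (b) Let $(\tau_j)_{j\ge1}$ be any enumeration without repetition of the tiles of $\mathcal{T}$ by nondecreasing distance from the origin. Then $$\lim_{n\to\infty}\ \frac1n\,\bigl|\{\,1\le j\le n : \alpha(\tau_j)\in[x,y]\,\}\bigr|=\frac{y-x}{2\pi}.$$ Theorem. Let $\sigma$ be a primitive self-similar substitution in the plane as above, and let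 $\mathcal{T}\in X_\sigma$ be pinwheel-like. Then $\mathcal{T}$ has statistical circular symmetry. Consequently every tiling in $X_\sigma$ has statistical circular symmetry. -/

import Mathlib

open Set Filter Topology
open scoped Pointwise

noncomputable section

namespace PlaneTiling

/-- The Euclidean group `E(2)` of the plane `ℂ`: all maps `z ↦ a z + t` and `z ↦ a (conj z) + t`
with `|a| = 1` (rotations, reflections, translations and their composites). -/
abbrev Motion : Type := ℂ ≃ᵃⁱ[ℝ] ℂ

/-- A marked tile: a congruent copy `pos (T_kind)` of the prototile with index `kind`. Recording the
motion and not only the point set marks the tile, so that type and orientation are well defined also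
when a prototile has symmetries or two prototiles are congruent. -/
@[ext]
structure Tile (ι : Type*) where
  kind : ι
  pos : Motion

variable {ι : Type*}

/-- The image of a tile under a motion. -/
def Tile.move (g : Motion) (T : Tile ι) : Tile ι := ⟨T.kind, g * T.pos⟩

/-- The orientation `α(T) ∈ [0, 2π)`: it is `α` for `T = R_α T_i + t`, and also for the copy
`T = R_α (conj T_i) + t` of the mirror image of the prototile, as in both cases the linear part maps
`1` to `exp (i α)`. -/
def Tile.angle (T : Tile ι) : ℝ :=
  toIcoMod Real.two_pi_pos 0 (Complex.arg (T.pos.linearIsometryEquiv 1))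

/-- For `g z = A z + t` with `A` linear, the motion `z ↦ A z + c t`. -/
def Motion.inflate (c : ℝ) (g : Motion) : Motion :=
  AffineIsometryEquiv.constVAdd ℝ ℂ (c • g 0) * g.linearIsometryEquiv.toAffineIsometryEquiv

/-- The data of a substitution in the plane: prototiles `T_i`, finite sets `Φ_ij` of motions, and
the factor `λ` by which the substitution stretches translations. -/
structure Substitution (ι : Type*) where
  proto : ι → Set ℂ
  isCompact_proto : ∀ i, IsCompact (proto i)
  nonempty_interior_proto : ∀ i, (interior (proto i)).Nonempty
  maps : ι → ι → Finset Motion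
  factor : ℝ

namespace Substitution

variable (σ : Substitution ι)

/-- The point set covered by a tile. -/
def support (T : Tile ι) : Set ℂ := T.pos '' σ.proto T.kind

/-- The tiles overlap at most in boundary points. -/
def IsPacking (P : Set (Tile ι)) : Prop :=
  P.Pairwise fun T T' => Disjoint (interior (σ.support T)) (interior (σ.support T'))

/-- The prototile `T_i` as a tile. -/
def protoTile (i : ι) : Tile ι := ⟨i, 1⟩

/-- `σ` on a tile: for `T = A T_i + t`, the tiles `A (φ T_j) + λ t` with `φ ∈ Φ_ij`. -/
def substTile (T : Tile ι) : Set (Tile ι) :=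
  {T' | ∃ φ ∈ σ.maps T.kind T'.kind, T'.pos = Motion.inflate σ.factor T.pos * φ}

/-- `σ` on a collection of tiles. -/
def subst (P : Set (Tile ι)) : Set (Tile ι) := ⋃ T ∈ P, σ.substTile T

/-- The supertile `σ^n(T_i)`. -/
def supertile (n : ℕ) (i : ι) : Set (Tile ι) := σ.subst^[n] {protoTile i}

/-- Self-similarity: `λ > 1`, and `σ(T_i)` is a dissection of `λ T_i` for every `i`. -/
structure IsSelfSimilar : Prop where
  one_lt_factor : 1 < σ.factor
  smul_proto_eq : ∀ i, σ.factor • σ.proto i = ⋃ T ∈ σ.substTile (protoTile i), σ.support T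
  isPacking : ∀ i, σ.IsPacking (σ.substTile (protoTile i))

/-- The substitution matrix `(|Φ_ij|)`. -/
def matrix : Matrix ι ι ℤ := Matrix.of fun i j => ((σ.maps i j).card : ℤ)

/-- A tiling: a packing of the plane which covers the plane. -/
structure IsTiling (𝒯 : Set (Tile ι)) : Prop where
  isPacking : σ.IsPacking 𝒯
  covers : ⋃ T ∈ 𝒯, σ.support T = univ

/-- The tiling space `X_σ`: the tilings all of whose patches (finite subsets) are congruent to
patches of supertiles `σ^n(T_i)`. -/
def tilingSpace : Set (Set (Tile ι)) :=
  {𝒯 | σ.IsTiling 𝒯 ∧ ∀ P ⊆ 𝒯, P.Finite →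
    ∃ (n : ℕ) (i : ι) (g : Motion), Tile.move g '' P ⊆ σ.supertile n i}

/-- Congruent to a supertile `σ^k(T_i)`. -/
def IsSupertile (P : Set (Tile ι)) : Prop :=
  ∃ (k : ℕ) (i : ι) (g : Motion), P = Tile.move g '' σ.supertile k i

/-- The sequence `s` enumerates the tiles of `𝒯` without repetition, and arbitrarily long initial
segments of it consist of exactly the tiles of some supertile. -/
def IsOrderedAlongSupertiles (𝒯 : Set (Tile ι)) (s : ℕ → Tile ι) : Prop :=
  BijOn s univ 𝒯 ∧ ∀ n, ∃ l ≥ n, σ.IsSupertile (s '' Iio l)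

/-- The sequence `s` enumerates the tiles of `𝒯` without repetition, by nondecreasing distance from
the origin. -/
def IsOrderedByDistance (𝒯 : Set (Tile ι)) (s : ℕ → Tile ι) : Prop :=
  BijOn s univ 𝒯 ∧ Monotone fun j => Metric.infDist 0 (σ.support (s j))

end Substitution

/-- `𝒯` contains tiles in infinitely many orientations. -/
def IsPinwheelLike (𝒯 : Set (Tile ι)) : Prop := (Tile.angle '' 𝒯).Infinite

open Classical in
/-- The proportion of the orientations in `[x, y]` among the first `n` tiles of a sequence. -/
def angleFrequency (s : ℕ → Tile ι) (x y : ℝ) (n : ℕ) : ℝ :=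
  (((Finset.range n).filter fun j => (s j).angle ∈ Icc x y).card : ℝ) / n

/-- The orientations of the tiles of the sequence are uniformly distributed in `[0, 2π)`, where the
number `n` of tiles over which one averages tends to infinity within the set `N`. -/
def UniformlyDistributedAlong (N : Set ℕ) (s : ℕ → Tile ι) : Prop :=
  ∀ x y : ℝ, 0 ≤ x → x < y → y < 2 * Real.pi →
    Tendsto (angleFrequency s x y) (atTop ⊓ 𝓟 N) (𝓝 ((y - x) / (2 * Real.pi)))

/-- Statistical circular symmetry of a tiling: the orientations are uniformly distributed for every
ordering of the tiles along supertiles, with averages over these supertiles, and for every ordering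
of the tiles by distance from the origin, with averages over all initial segments. (The second
ordering is available for every tiling in the tiling space, also for those which are not a union of
an increasing sequence of supertiles.) -/
structure Substitution.HasStatisticalCircularSymmetry (σ : Substitution ι)
    (𝒯 : Set (Tile ι)) : Prop where
  along_supertiles : ∀ s, σ.IsOrderedAlongSupertiles 𝒯 s →
    UniformlyDistributedAlong {n | σ.IsSupertile (s '' Iio n)} s
  by_distance : ∀ s, σ.IsOrderedByDistance 𝒯 s → UniformlyDistributedAlong univ s

end PlaneTiling

end

open MeasureTheory

noncomputable section

namespace PlaneTiling

variable {ι : Type*}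

/-! ### Motions -/

namespace Motion

/-! By Weyl's criterion it suffices that, for every `k ≠ 0`, the sums of `direction ^ k` over the
first `n` tiles are `o(n)`. Such sums are controlled first over supertiles, uniformly in the
supertile.

Substitution keeps linear parts, so the sum over `σ^n(T)` is multiplied by `u ^ k` when `T` is
rotated by `u`. Infinitely many orientations force two tiles of one kind and chirality that differ
by a rotation `u` with `u ^ k ≠ 1` (`IsPinwheelLike.exists_rotatedPair`). This pair is a patch,
hence occurs in a supertile, and by primitivity in every supertile of some level `n`
(`exists_rotatedPair_level`). Since `|1 + u ^ k| < 2`, the two contributions partly cancel. Measured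
against area, each passage through `n` levels thus gains a factor `δ < 1` over the trivial growth
`λ^(2n)` (`exists_contraction`). The number of tiles does grow like `λ^(2n)`, so the means over
supertiles tend to zero (`exists_norm_sum_level_le`). The pinwheel-like tiling enters only through
the pairs, whence the conclusion for all of `X_σ`.

For the ordering by distance, an initial segment splits into complete supertiles of a fixed level
and tiles near the boundary of a disc of radius `R`. The latter number `O(R)`, which is `O(√n)`
(`tendsto_mean_by_distance`).

Tile boundaries may have positive area. Upper bounds therefore use areas of interiors, which pack,
and lower bounds use areas of whole tiles, which cover. -/

theorem apply_eq (g : Motion) (z : ℂ) : g z = g.linearIsometryEquiv z + g 0 := by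
  simpa using g.map_vadd (0 : ℂ) z

theorem linear_mul_apply (g h : Motion) (z : ℂ) :
    (g * h).linearIsometryEquiv z = g.linearIsometryEquiv (h.linearIsometryEquiv z) := rfl

theorem linear_mul (g h : Motion) :
    (g * h).linearIsometryEquiv = g.linearIsometryEquiv * h.linearIsometryEquiv := rfl

theorem linear_inv (g : Motion) : (g⁻¹).linearIsometryEquiv = g.linearIsometryEquiv⁻¹ := rfl

theorem inflate_apply (c : ℝ) (g : Motion) (z : ℂ) :
    inflate c g z = g.linearIsometryEquiv z + c • g 0 := by
  simp [inflate, add_comm]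

@[simp]
theorem linear_inflate (c : ℝ) (g : Motion) :
    (inflate c g).linearIsometryEquiv = g.linearIsometryEquiv := by
  ext z
  have h := apply_eq (inflate c g) z
  rw [inflate_apply, inflate_apply] at h
  simpa using h.symm

/-- For `c ≠ 0`, inflation is conjugation by the dilation `z ↦ c z`, hence a homomorphism; the
computation also covers `c = 0`. -/
theorem inflate_mul (c : ℝ) (g h : Motion) : inflate c (g * h) = inflate c g * inflate c h := by
  ext z
  have h0 := apply_eq g (h 0)
  simp only [AffineIsometryEquiv.coe_mul, Function.comp_apply, inflate_apply, linear_mul_apply,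
    h0, map_add, map_smul, smul_add]
  ring

theorem inflate_inflate (a b : ℝ) (g : Motion) : inflate a (inflate b g) = inflate (a * b) g := by
  ext z
  simp [inflate_apply, mul_smul]

theorem inflate_surjective {c : ℝ} (hc : c ≠ 0) : Function.Surjective (inflate c) := by
  intro g
  refine ⟨inflate c⁻¹ g, ?_⟩
  rw [inflate_inflate, mul_inv_cancel₀ hc]
  ext z
  rw [inflate_apply, apply_eq g z, one_smul]

theorem inflate_apply_smul (c : ℝ) (g : Motion) (z : ℂ) : inflate c g (c • z) = c • g z := by
  rw [inflate_apply, apply_eq g z, map_smul, smul_add]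

/-- `n`-fold inflation does not change the linear part. -/
theorem linear_iterate_inflate (c : ℝ) (n : ℕ) (g : Motion) :
    ((inflate c)^[n] g).linearIsometryEquiv = g.linearIsometryEquiv := by
  induction n with
  | zero => rfl
  | succ n ih => rw [Function.iterate_succ_apply', linear_inflate, ih]

theorem measurePreserving (g : Motion) : MeasurePreserving g (volume : Measure ℂ) volume := by
  have h := (measurePreserving_add_right (volume : Measure ℂ) (g 0)).comp
    g.linearIsometryEquiv.measurePreserving
  rwa [show (fun x : ℂ => x + g 0) ∘ g.linearIsometryEquiv = g from
    funext fun z => (apply_eq g z).symm] at h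

theorem volume_image (g : Motion) (s : Set ℂ) : volume (g '' s) = volume s :=
  (g.measurePreserving.measure_preimage_equiv (f := g.toHomeomorph.toMeasurableEquiv)
    (g '' s)).symm.trans (congrArg volume (preimage_image_eq s g.injective))

end Motion

/-! ### Tiles -/

namespace Tile

@[simp] theorem move_kind (g : Motion) (T : Tile ι) : (T.move g).kind = T.kind := rfl

@[simp] theorem move_pos (g : Motion) (T : Tile ι) : (T.move g).pos = g * T.pos := rfl

theorem move_move (g h : Motion) (T : Tile ι) : (T.move h).move g = T.move (g * h) := by
  simp [Tile.ext_iff, mul_assoc]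

@[simp] theorem move_one (T : Tile ι) : T.move 1 = T := by simp [Tile.ext_iff]

theorem move_injective (g : Motion) : Function.Injective (move g : Tile ι → Tile ι) := by
  intro S T h
  simpa [Tile.ext_iff] using h

theorem move_protoTile (T : Tile ι) : (Substitution.protoTile T.kind).move T.pos = T := by
  simp [Tile.ext_iff, Substitution.protoTile]

end Tile

namespace Substitution

variable (σ : Substitution ι)

/-! ### Supports -/

theorem support_move (g : Motion) (T : Tile ι) :
    σ.support (T.move g) = g '' σ.support T := by
  simp [support, image_image]

theorem isCompact_support (T : Tile ι) : IsCompact (σ.support T) :=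
  (σ.isCompact_proto _).image T.pos.continuous

theorem interior_support (T : Tile ι) :
    interior (σ.support T) = T.pos '' interior (σ.proto T.kind) :=
  (T.pos.toHomeomorph.image_interior _).symm

theorem nonempty_interior_support (T : Tile ι) : (interior (σ.support T)).Nonempty := by
  rw [interior_support]
  exact (σ.nonempty_interior_proto _).image _

theorem nonempty_support (T : Tile ι) : (σ.support T).Nonempty :=
  (σ.nonempty_interior_support T).mono interior_subset

/-- The area of the interior of a tile. -/
def innerArea (T : Tile ι) : ℝ := volume.real (interior (σ.proto T.kind))

theorem innerArea_move (g : Motion) (T : Tile ι) : σ.innerArea (T.move g) = σ.innerArea T := rfl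

theorem volume_interior_support_ne_top (T : Tile ι) : volume (interior (σ.support T)) ≠ ⊤ :=
  measure_ne_top_of_subset interior_subset (σ.isCompact_support T).measure_ne_top

theorem innerArea_eq (T : Tile ι) : σ.innerArea T = volume.real (interior (σ.support T)) := by
  rw [interior_support, measureReal_def, Motion.volume_image, innerArea, measureReal_def]

theorem innerArea_pos (T : Tile ι) : 0 < σ.innerArea T := by
  rw [innerArea_eq, measureReal_def]
  exact ENNReal.toReal_pos (isOpen_interior.measure_pos _ (σ.nonempty_interior_support T)).ne'
    (σ.volume_interior_support_ne_top T)

/-- The area of a tile. -/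
def area (T : Tile ι) : ℝ := volume.real (σ.proto T.kind)

theorem area_eq (T : Tile ι) : σ.area T = volume.real (σ.support T) := by
  rw [support, measureReal_def, Motion.volume_image, area, measureReal_def]

theorem innerArea_le_area (T : Tile ι) : σ.innerArea T ≤ σ.area T :=
  measureReal_mono interior_subset (σ.isCompact_proto _).measure_ne_top

theorem area_pos (T : Tile ι) : 0 < σ.area T := (σ.innerArea_pos T).trans_le (σ.innerArea_le_area T)

theorem exists_innerArea_ge [Finite ι] : ∃ b > 0, ∀ T : Tile ι, b ≤ σ.innerArea T := by
  cases isEmpty_or_nonempty ι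
  · exact ⟨1, one_pos, fun T => isEmptyElim T.kind⟩
  · obtain ⟨i, hi⟩ := Finite.exists_min fun i => σ.innerArea (protoTile i)
    exact ⟨_, σ.innerArea_pos (protoTile i), fun T => hi T.kind⟩

theorem exists_area_le [Finite ι] : ∃ a > 0, ∀ T : Tile ι, σ.area T ≤ a := by
  cases isEmpty_or_nonempty ι
  · exact ⟨1, one_pos, fun T => isEmptyElim T.kind⟩
  · obtain ⟨i, hi⟩ := Finite.exists_max fun i => σ.area (protoTile i)
    exact ⟨_, σ.area_pos (protoTile i), fun T => hi T.kind⟩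

/-- The tiles of a finite packing inside a set have total inner area at most that of the set. -/
theorem sum_innerArea_le {P : Finset (Tile ι)} (hP : σ.IsPacking P) {U : Set ℂ}
    (hU : volume U ≠ ⊤) (hPU : ∀ T ∈ P, interior (σ.support T) ⊆ U) :
    ∑ T ∈ P, σ.innerArea T ≤ volume.real U := by
  simp_rw [innerArea_eq]
  rw [← measureReal_biUnion_finset hP (fun T _ => isOpen_interior.measurableSet)
    (fun T _ => σ.volume_interior_support_ne_top T)]
  exact measureReal_mono (iUnion₂_subset hPU) hU

/-- If a finite collection of tiles covers a set, its total area is at least that of the set. -/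
theorem le_sum_area {P : Finset (Tile ι)} {U : Set ℂ} (hU : U ⊆ ⋃ T ∈ P, σ.support T) :
    volume.real U ≤ ∑ T ∈ P, σ.area T := by
  simp_rw [area_eq]
  refine (measureReal_mono hU ?_).trans (measureReal_biUnion_finset_le _ _)
  exact (P.isCompact_biUnion fun T _ => σ.isCompact_support T).measure_ne_top

/-! ### Iterated substitution -/

/-- The patch `σ^n(P)`. -/
abbrev iter (n : ℕ) (P : Set (Tile ι)) : Set (Tile ι) := σ.subst^[n] P

theorem substTile_move (g : Motion) (T : Tile ι) :
    σ.substTile (T.move g) = Tile.move (Motion.inflate σ.factor g) '' σ.substTile T := by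
  ext S
  constructor
  · rintro ⟨φ, hφ, h⟩
    refine ⟨⟨S.kind, Motion.inflate σ.factor T.pos * φ⟩, ⟨φ, hφ, rfl⟩, ?_⟩
    ext1
    · rfl
    · simp [h, Motion.inflate_mul, mul_assoc]
  · rintro ⟨S, ⟨φ, hφ, h⟩, rfl⟩
    exact ⟨φ, hφ, by simp [h, Motion.inflate_mul, mul_assoc]⟩

theorem subst_move (g : Motion) (P : Set (Tile ι)) :
    σ.subst (Tile.move g '' P) = Tile.move (Motion.inflate σ.factor g) '' σ.subst P := by
  simp [subst, image_iUnion₂, substTile_move]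

theorem iter_move (n : ℕ) (g : Motion) (P : Set (Tile ι)) :
    σ.iter n (Tile.move g '' P) = Tile.move ((Motion.inflate σ.factor)^[n] g) '' σ.iter n P := by
  induction n with
  | zero => rfl
  | succ n ih => simp only [iter, Function.iterate_succ_apply'] at ih ⊢; rw [ih, subst_move]

theorem subst_iUnion {κ : Type*} (P : κ → Set (Tile ι)) :
    σ.subst (⋃ i, P i) = ⋃ i, σ.subst (P i) := by
  simp only [subst, biUnion_iUnion]

theorem iter_iUnion {κ : Type*} (n : ℕ) (P : κ → Set (Tile ι)) :
    σ.iter n (⋃ i, P i) = ⋃ i, σ.iter n (P i) := by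
  induction n with
  | zero => rfl
  | succ n ih => simp only [iter, Function.iterate_succ_apply'] at ih ⊢; rw [ih, subst_iUnion]

theorem iter_add (m n : ℕ) (P : Set (Tile ι)) : σ.iter (m + n) P = σ.iter m (σ.iter n P) :=
  Function.iterate_add_apply _ _ _ _

theorem iter_eq_biUnion (n : ℕ) (P : Set (Tile ι)) : σ.iter n P = ⋃ T ∈ P, σ.iter n {T} := by
  conv_lhs => rw [← biUnion_of_singleton P]
  rw [biUnion_eq_iUnion, iter_iUnion, biUnion_eq_iUnion]

theorem finite_substTile [Finite ι] (T : Tile ι) : (σ.substTile T).Finite := by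
  refine (finite_iUnion fun j => ((σ.maps T.kind j).finite_toSet.image
    fun φ => (⟨j, Motion.inflate σ.factor T.pos * φ⟩ : Tile ι))).subset ?_
  rintro S ⟨φ, hφ, h⟩
  exact mem_iUnion.2 ⟨S.kind, φ, hφ, Tile.ext rfl h.symm⟩

theorem finite_iter [Finite ι] (n : ℕ) {P : Set (Tile ι)} (hP : P.Finite) :
    (σ.iter n P).Finite := by
  induction n with
  | zero => exact hP
  | succ n ih =>
    simp only [iter, Function.iterate_succ_apply'] at ih ⊢
    exact ih.biUnion fun T _ => σ.finite_substTile T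

/-- The supertile `σ^n(T)` of a tile `T` as a finite set. -/
def level [Finite ι] (n : ℕ) (T : Tile ι) : Finset (Tile ι) :=
  (σ.finite_iter n (finite_singleton T)).toFinset

@[simp]
theorem coe_level [Finite ι] (n : ℕ) (T : Tile ι) :
    (σ.level n T : Set (Tile ι)) = σ.iter n {T} := by
  simp [level]

theorem mem_level [Finite ι] {n : ℕ} {S T : Tile ι} : S ∈ σ.level n T ↔ S ∈ σ.iter n {T} := by
  simp [level]

theorem level_move [Finite ι] [DecidableEq (Tile ι)] (n : ℕ) (g : Motion) (T : Tile ι) :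
    σ.level n (T.move g) =
      (σ.level n T).image (Tile.move ((Motion.inflate σ.factor)^[n] g)) := by
  rw [← Finset.coe_inj, coe_level, Finset.coe_image, coe_level, ← iter_move, image_singleton]

theorem level_add [Finite ι] [DecidableEq (Tile ι)] (m n : ℕ) (T : Tile ι) :
    σ.level (m + n) T = (σ.level n T).biUnion (σ.level m) := by
  rw [← Finset.coe_inj, coe_level, Finset.coe_biUnion, iter_add, iter_eq_biUnion]
  simp

theorem level_zero [Finite ι] (T : Tile ι) : σ.level 0 T = {T} := by
  rw [← Finset.coe_inj]
  simp [iter]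

theorem card_level_move [Finite ι] (n : ℕ) (g : Motion) (T : Tile ι) :
    (σ.level n (T.move g)).card = (σ.level n T).card := by
  classical
  rw [level_move, Finset.card_image_of_injective _ (Tile.move_injective _)]

theorem card_level [Finite ι] (n : ℕ) (T : Tile ι) :
    (σ.level n T).card = (σ.level n (protoTile T.kind)).card := by
  conv_lhs => rw [← T.move_protoTile, card_level_move]

/-- A patch congruent to a supertile `σ^n(T_i)` is of the form `σ^n(T)` for a tile `T`. -/
theorem exists_move_supertile_eq [Finite ι] (h0 : σ.factor ≠ 0) (n : ℕ) (i : ι) (g : Motion) :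
    ∃ T : Tile ι, Tile.move g '' σ.supertile n i = σ.level n T := by
  -- A motion of a supertile comes from a motion of its seed tile, because `n`-fold inflation is
  -- onto.
  obtain ⟨h, rfl⟩ := (Motion.inflate_surjective h0).iterate n g
  refine ⟨(protoTile i).move h, ?_⟩
  rw [coe_level, ← image_singleton, iter_move]
  rfl

/-! ### Consequences of self-similarity -/

variable {σ}

namespace IsSelfSimilar

theorem factor_pos (hσ : σ.IsSelfSimilar) : 0 < σ.factor := one_pos.trans hσ.one_lt_factor

theorem factor_ne_zero (hσ : σ.IsSelfSimilar) : σ.factor ≠ 0 := hσ.factor_pos.ne'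

theorem biUnion_support_substTile (hσ : σ.IsSelfSimilar) (T : Tile ι) :
    ⋃ S ∈ σ.substTile T, σ.support S = σ.factor • σ.support T := by
  conv_lhs => rw [← T.move_protoTile, substTile_move, biUnion_image]
  simp_rw [support_move, ← image_iUnion₂]
  rw [← hσ.smul_proto_eq, support]
  ext z
  simp only [mem_image, mem_smul_set, exists_exists_and_eq_and, Motion.inflate_apply_smul]

theorem isPacking_substTile (hσ : σ.IsSelfSimilar) (T : Tile ι) : σ.IsPacking (σ.substTile T) := by
  rw [← T.move_protoTile, substTile_move]
  rintro _ ⟨S, hS, rfl⟩ _ ⟨S', hS', rfl⟩ hne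
  set g := Motion.inflate σ.factor T.pos
  rw [support_move, support_move]
  have e := fun s : Set ℂ => g.toHomeomorph.image_interior s
  have h := hσ.isPacking T.kind hS hS' (fun h => hne (by rw [h]))
  have h' := h.image (f := g) (u := univ) g.injective.injOn (subset_univ _) (subset_univ _)
  rw [show g '' interior (σ.support S) = _ from e _,
    show g '' interior (σ.support S') = _ from e _] at h'
  exact h'

theorem biUnion_support_subst (hσ : σ.IsSelfSimilar) (P : Set (Tile ι)) :
    ⋃ S ∈ σ.subst P, σ.support S = σ.factor • ⋃ T ∈ P, σ.support T := by
  rw [subst, biUnion_iUnion, smul_set_iUnion₂]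
  simp_rw [biUnion_iUnion, hσ.biUnion_support_substTile]

theorem biUnion_support_iter (hσ : σ.IsSelfSimilar) (n : ℕ) (P : Set (Tile ι)) :
    ⋃ S ∈ σ.iter n P, σ.support S = σ.factor ^ n • ⋃ T ∈ P, σ.support T := by
  induction n with
  | zero => simp [iter]
  | succ n ih =>
    simp only [iter, Function.iterate_succ_apply'] at ih ⊢
    rw [hσ.biUnion_support_subst, ih, smul_smul, pow_succ']

theorem support_subset_of_mem_iter (hσ : σ.IsSelfSimilar) {n : ℕ} {S T : Tile ι}
    (hS : S ∈ σ.iter n {T}) :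
    σ.support S ⊆ σ.factor ^ n • σ.support T := by
  have h := hσ.biUnion_support_iter n {T}
  rw [biUnion_singleton] at h
  rw [← h]
  exact subset_biUnion_of_mem (u := σ.support) hS

theorem interior_support_subset_of_mem_iter (hσ : σ.IsSelfSimilar) {n : ℕ} {S T : Tile ι}
    (hS : S ∈ σ.iter n {T}) :
    interior (σ.support S) ⊆ σ.factor ^ n • interior (σ.support T) := by
  rw [← interior_smul₀ (pow_ne_zero n hσ.factor_ne_zero)]
  exact interior_mono (hσ.support_subset_of_mem_iter hS)

theorem isPacking_subst (hσ : σ.IsSelfSimilar) {P : Set (Tile ι)} (hP : σ.IsPacking P) :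
    σ.IsPacking (σ.subst P) := by
  intro S hS S' hS' hne
  obtain ⟨T, hT, hS⟩ := mem_iUnion₂.1 hS
  obtain ⟨T', hT', hS'⟩ := mem_iUnion₂.1 hS'
  rcases eq_or_ne T T' with rfl | hTT
  · exact hσ.isPacking_substTile T hS hS' hne
  · have key : ∀ {A B : Tile ι}, B ∈ σ.substTile A →
        interior (σ.support B) ⊆ σ.factor • interior (σ.support A) := fun {A B} h => by
      simpa using hσ.interior_support_subset_of_mem_iter (n := 1) (T := A) (S := B)
        (by simpa [iter, subst] using h)
    refine Disjoint.mono (key hS) (key hS') ?_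
    exact (disjoint_image_iff (smul_right_injective ℂ hσ.factor_ne_zero)).2 (hP hT hT' hTT)

theorem isPacking_iter (hσ : σ.IsSelfSimilar) (n : ℕ) {P : Set (Tile ι)} (hP : σ.IsPacking P) :
    σ.IsPacking (σ.iter n P) := by
  induction n with
  | zero => exact hP
  | succ n ih =>
    simp only [iter, Function.iterate_succ_apply'] at ih ⊢
    exact hσ.isPacking_subst ih

theorem isPacking_level (hσ : σ.IsSelfSimilar) [Finite ι] (n : ℕ) (T : Tile ι) :
    σ.IsPacking (σ.level n T) := by
  rw [coe_level]
  exact hσ.isPacking_iter n (pairwise_singleton _ _)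

/-- A common tile would have nonempty interior inside both inflated interiors, which are disjoint.
-/
theorem disjoint_level (hσ : σ.IsSelfSimilar) [Finite ι] (n : ℕ) {S T : Tile ι}
    (h : Disjoint (interior (σ.support S)) (interior (σ.support T))) :
    Disjoint (σ.level n S) (σ.level n T) := by
  rw [Finset.disjoint_left]
  intro A hS hT
  rw [mem_level] at hS hT
  obtain ⟨z, hz⟩ := σ.nonempty_interior_support A
  have h' := (disjoint_image_iff (smul_right_injective ℂ (pow_ne_zero n hσ.factor_ne_zero))).2 h
  exact disjoint_left.1 h' (hσ.interior_support_subset_of_mem_iter hS hz)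
    (hσ.interior_support_subset_of_mem_iter hT hz)

theorem pairwiseDisjoint_level (hσ : σ.IsSelfSimilar) [Finite ι] (m n : ℕ) (T : Tile ι) :
    (σ.level n T : Set (Tile ι)).PairwiseDisjoint (σ.level m) :=
  fun _ hA _ hB hne => hσ.disjoint_level m (hσ.isPacking_level n T hA hB hne)

theorem sum_level_add (hσ : σ.IsSelfSimilar) [Finite ι] {M : Type*} [AddCommMonoid M] (m n : ℕ)
    (T : Tile ι)
    (F : Tile ι → M) :
    ∑ S ∈ σ.level (m + n) T, F S = ∑ A ∈ σ.level n T, ∑ S ∈ σ.level m A, F S := by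
  classical
  rw [level_add, Finset.sum_biUnion (hσ.pairwiseDisjoint_level m n T)]

/-- The interiors of the tiles of the supertile are disjoint and lie in the inflated interior of
`T`. -/
theorem sum_innerArea_level_le (hσ : σ.IsSelfSimilar) [Finite ι] (n : ℕ) (T : Tile ι) :
    ∑ S ∈ σ.level n T, σ.innerArea S ≤ (σ.factor ^ n) ^ 2 * σ.innerArea T := by
  have h0 : 0 ≤ σ.factor ^ n := pow_nonneg hσ.factor_pos.le n
  have hv : volume (σ.factor ^ n • interior (σ.support T)) =
      ENNReal.ofReal ((σ.factor ^ n) ^ 2) * volume (interior (σ.support T)) := by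
    rw [Measure.addHaar_smul_of_nonneg _ h0, Complex.finrank_real_complex]
  have := σ.sum_innerArea_le (hσ.isPacking_level n T)
    (U := σ.factor ^ n • interior (σ.support T))
    (hv ▸ ENNReal.mul_ne_top ENNReal.ofReal_ne_top (σ.volume_interior_support_ne_top T))
    (fun S hS => hσ.interior_support_subset_of_mem_iter (σ.mem_level.1 hS))
  rwa [measureReal_def, hv, ENNReal.toReal_mul, ENNReal.toReal_ofReal (by positivity),
    ← measureReal_def, ← innerArea_eq] at this

theorem le_sum_area_level (hσ : σ.IsSelfSimilar) [Finite ι] (n : ℕ) (T : Tile ι) :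
    (σ.factor ^ n) ^ 2 * σ.area T ≤ ∑ S ∈ σ.level n T, σ.area S := by
  have h0 : 0 ≤ σ.factor ^ n := pow_nonneg hσ.factor_pos.le n
  have := σ.le_sum_area (P := σ.level n T) (U := σ.factor ^ n • σ.support T) (by
    have h := hσ.biUnion_support_iter n {T}
    rw [biUnion_singleton] at h
    rw [← h]
    simp [mem_level])
  rwa [measureReal_def, Measure.addHaar_smul_of_nonneg _ h0, Complex.finrank_real_complex,
    ENNReal.toReal_mul, ENNReal.toReal_ofReal (by positivity), ← measureReal_def, ← area_eq] at this

end IsSelfSimilar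

end Substitution

/-! ### Orientations -/

namespace Tile

/-- The unit complex number `exp (i α(T))`. -/
def direction (T : Tile ι) : ℂ := T.pos.linearIsometryEquiv 1

@[simp]
theorem norm_direction (T : Tile ι) : ‖T.direction‖ = 1 := by
  simp [direction]

theorem angle_mem_Ico (T : Tile ι) : T.angle ∈ Ico 0 (2 * Real.pi) := by
  have h := toIcoMod_mem_Ico Real.two_pi_pos 0 (Complex.arg T.direction)
  rwa [zero_add] at h

theorem exp_angle (T : Tile ι) : Complex.exp (T.angle * Complex.I) = T.direction := by
  have h : T.angle = Complex.arg T.direction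
      - toIcoDiv Real.two_pi_pos 0 (Complex.arg T.direction) * (2 * Real.pi) := by
    rw [← zsmul_eq_mul]
    rfl
  have h2 := Complex.norm_mul_exp_arg_mul_I T.direction
  rw [norm_direction, Complex.ofReal_one, one_mul] at h2
  rw [h]
  push_cast
  rw [sub_mul, Complex.exp_sub, h2, mul_assoc, mul_assoc, ← mul_assoc 2,
    Complex.exp_int_mul_two_pi_mul_I, div_one]

theorem direction_move {g : Motion} {u : Circle} (hg : g.linearIsometryEquiv = rotation u)
    (T : Tile ι) : (T.move g).direction = u * T.direction := by
  rw [direction, move_pos, Motion.linear_mul_apply, hg, rotation_apply, direction]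

end Tile

/-- Rotations commute with each other and reflections invert them. Congruence thus preserves rotated
pairs: the inverse is absorbed by exchanging the two tiles. -/
theorem linear_conj_rotation (A : ℂ ≃ₗᵢ[ℝ] ℂ) (u : Circle) :
    A * rotation u * A⁻¹ = rotation u ∨ A * rotation u * A⁻¹ = rotation u⁻¹ := by
  simp only [mul_inv_eq_iff_eq_mul]
  obtain ⟨a, rfl | rfl⟩ := linear_isometry_complex A
  · left
    rw [← map_mul, ← map_mul, mul_comm]
  · right
    ext z
    simp only [LinearIsometryEquiv.coe_mul, Function.comp_apply, LinearIsometryEquiv.trans_apply,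
      Complex.conjLIE_apply, rotation_apply, map_mul, Circle.coe_inv_eq_conj]
    ring

/-- The patch contains two tiles of the same kind which differ by a motion that rotates by `u`. -/
def RotatedPair (u : Circle) (P : Set (Tile ι)) : Prop :=
  ∃ S ∈ P, ∃ h : Motion, h.linearIsometryEquiv = rotation u ∧ S.move h ∈ P

namespace RotatedPair

variable {u : Circle} {P Q : Set (Tile ι)}

theorem mono (h : RotatedPair u P) (hPQ : P ⊆ Q) : RotatedPair u Q := by
  obtain ⟨S, hS, g, hg, hS'⟩ := h
  exact ⟨S, hPQ hS, g, hg, hPQ hS'⟩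

theorem inv (h : RotatedPair u P) : RotatedPair u⁻¹ P := by
  obtain ⟨S, hS, g, hg, hS'⟩ := h
  refine ⟨_, hS', g⁻¹, ?_, ?_⟩
  · rw [Motion.linear_inv, hg, map_inv]
  · rwa [Tile.move_move, inv_mul_cancel, Tile.move_one]

theorem move (h : RotatedPair u P) (g : Motion) : RotatedPair u (Tile.move g '' P) := by
  obtain ⟨S, hS, f, hf, hS'⟩ := h
  have key : ∀ v : Circle, (g * f * g⁻¹).linearIsometryEquiv = rotation v →
      RotatedPair v (Tile.move g '' P) := fun v hv => by
    refine ⟨_, mem_image_of_mem _ hS, g * f * g⁻¹, hv, S.move f, hS', ?_⟩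
    rw [Tile.move_move, Tile.move_move, inv_mul_cancel_right]
  have h := linear_conj_rotation g.linearIsometryEquiv u
  rw [← hf] at h
  rcases h with h | h
  · exact key u (h.trans hf)
  · exact inv_inv u ▸ (key u⁻¹ h).inv

end RotatedPair

/-- Among infinitely many orientations there are two, for tiles of the same kind, which differ by
a rotation whose `k`-th power is not trivial. -/
theorem IsPinwheelLike.exists_rotatedPair [Finite ι] {𝒯 : Set (Tile ι)} (h : IsPinwheelLike 𝒯)
    {k : ℤ} (hk : k ≠ 0) : ∃ u : Circle, u ^ k ≠ 1 ∧ RotatedPair u 𝒯 := by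
  by_contra! hcon
  refine h ?_
  -- Kind and chirality give finitely many classes, and within a class any two tiles differ by a
  -- motion with rotational linear part. If all such rotations have trivial `k`-th power, `direction
  -- ^ k` is constant on each class.
  let c : Tile ι → ι × Prop := fun T => (T.kind, ∃ u, T.pos.linearIsometryEquiv = rotation u)
  have hc : ∀ S ∈ 𝒯, ∀ T ∈ 𝒯, c S = c T → S.direction ^ k = T.direction ^ k := by
    intro S hS T hT hST
    have hkind : S.kind = T.kind := congrArg Prod.fst hST
    have hrot : (∃ u, S.pos.linearIsometryEquiv = rotation u) ↔
        ∃ u, T.pos.linearIsometryEquiv = rotation u := (congrArg Prod.snd hST).to_iff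
    have hu : ∃ u, (T.pos * S.pos⁻¹).linearIsometryEquiv = rotation u := by
      by_cases hS' : ∃ u, S.pos.linearIsometryEquiv = rotation u
      · obtain ⟨v, hv⟩ := hrot.1 hS'
        obtain ⟨u, hu⟩ := hS'
        exact ⟨v * u⁻¹, by rw [Motion.linear_mul, Motion.linear_inv, hu, hv, map_mul, map_inv]⟩
      · have hT' : ¬ ∃ u, T.pos.linearIsometryEquiv = rotation u := by
          rwa [← hrot]
        obtain ⟨u, hu⟩ := linear_isometry_complex S.pos.linearIsometryEquiv
        obtain ⟨v, hv⟩ := linear_isometry_complex T.pos.linearIsometryEquiv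
        replace hu := hu.resolve_left fun h => hS' ⟨u, h⟩
        replace hv := hv.resolve_left fun h => hT' ⟨v, h⟩
        refine ⟨v * u⁻¹, ?_⟩
        rw [Motion.linear_mul, Motion.linear_inv, mul_inv_eq_iff_eq_mul, hu, hv]
        ext z
        simp only [LinearIsometryEquiv.coe_mul, Function.comp_apply,
          LinearIsometryEquiv.trans_apply, rotation_apply, ← mul_assoc, ← Circle.coe_mul,
          inv_mul_cancel_right]
    obtain ⟨u, hu⟩ := hu
    have hST' : S.move (T.pos * S.pos⁻¹) = T := Tile.ext hkind (by simp)
    have huk : u ^ k = 1 := by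
      by_contra hne
      exact hcon u hne ⟨S, hS, _, hu, by rwa [hST']⟩
    have hd := Tile.direction_move hu S
    rw [hST'] at hd
    rw [hd, mul_zpow, ← Circle.coe_zpow, huk, Circle.coe_one, one_mul]
  have hfin : ((fun T : Tile ι => T.direction ^ k) '' 𝒯).Finite := by
    have : (range fun p : ↥(c '' 𝒯) => p.2.choose.direction ^ k).Finite := finite_range _
    refine this.subset ?_
    rintro _ ⟨T, hT, rfl⟩
    have hcT : c T ∈ c '' 𝒯 := mem_image_of_mem c hT
    exact ⟨⟨c T, hcT⟩, hc _ hcT.choose_spec.1 _ hT hcT.choose_spec.2⟩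
  have hdir : (Tile.direction '' 𝒯).Finite := by
    refine Finite.of_finite_fibers (f := fun z : ℂ => z ^ k) ?_ ?_
    · rwa [image_image]
    · rintro w -
      have hn : 0 < k.natAbs := Int.natAbs_pos.2 hk
      -- For negative `k`, the equation `z ^ k = w` reads `z ^ |k| = w⁻¹`.
      refine ((Polynomial.nthRoots k.natAbs w).toFinset.finite_toSet.union
        (Polynomial.nthRoots k.natAbs w⁻¹).toFinset.finite_toSet).subset ?_
      rintro z ⟨-, hz⟩
      simp only [mem_preimage, mem_singleton_iff] at hz
      simp only [mem_union, Finset.mem_coe, Multiset.mem_toFinset, Polynomial.mem_nthRoots hn]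
      rcases Int.natAbs_eq k with h | h
      · left
        rw [← hz]
        conv_rhs => rw [h, zpow_natCast]
      · right
        rw [← hz]
        conv_rhs => rw [h, zpow_neg, zpow_natCast, inv_inv]
  have : Tile.angle '' 𝒯 ⊆
      (fun z : ℂ => toIcoMod Real.two_pi_pos 0 (Complex.arg z)) '' (Tile.direction '' 𝒯) := by
    rintro _ ⟨T, hT, rfl⟩
    exact ⟨_, ⟨T, hT, rfl⟩, rfl⟩
  exact (hdir.image _).subset this

/-- Equality in the triangle inequality would put the unit vectors `1` and `w` on the same ray. This
is the source of the cancellation. -/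
theorem norm_one_add_lt_two {w : Circle} (hw : w ≠ 1) : ‖1 + (w : ℂ)‖ < 2 := by
  refine lt_of_le_of_ne ((norm_add_le _ _).trans_eq
    (by rw [norm_one, Circle.norm_coe]; norm_num)) fun h => hw ?_
  have h1 : SameRay ℝ (1 : ℂ) w :=
    sameRay_iff_norm_add.2 (by rw [h, norm_one, Circle.norm_coe]; norm_num)
  have h2 := (sameRay_iff_of_norm_eq (by rw [norm_one, Circle.norm_coe])).1 h1
  exact Circle.ext h2.symm

/-! ### Weighted sums over supertiles -/

/-- `F` depends on the linear part of a tile only, and transforms under rotations by the `k`-th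
power. -/
def IsEquivariant (k : ℤ) (F : Tile ι → ℂ) : Prop :=
  ∀ (g : Motion) (u : Circle) (T : Tile ι), g.linearIsometryEquiv = rotation u →
    F (T.move g) = ((u ^ k : Circle) : ℂ) * F T

theorem isEquivariant_direction_zpow (k : ℤ) :
    IsEquivariant k fun T : Tile ι => T.direction ^ k := by
  intro g u T hg
  simp only [Tile.direction_move hg, mul_zpow, Circle.coe_zpow]

namespace Substitution

variable {σ : Substitution ι}

theorem exists_mem_iter_of_pow_ne_zero [Fintype ι] [DecidableEq ι] (n : ℕ) (i j : ι)
    (h : (σ.matrix ^ n) i j ≠ 0) : ∃ S ∈ σ.iter n {protoTile i}, S.kind = j := by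
  induction n generalizing j with
  | zero =>
    refine ⟨protoTile i, rfl, ?_⟩
    by_contra hne
    exact h (by rw [pow_zero]; exact Matrix.one_apply_ne hne)
  | succ n ih =>
    rw [pow_succ, Matrix.mul_apply] at h
    obtain ⟨l, -, hl⟩ := Finset.exists_ne_zero_of_sum_ne_zero h
    obtain ⟨S, hS, rfl⟩ := ih l (left_ne_zero_of_mul hl)
    have hcard : (σ.maps S.kind j).card ≠ 0 := by
      simpa [matrix] using right_ne_zero_of_mul hl
    obtain ⟨φ, hφ⟩ := Finset.card_ne_zero.1 hcard
    refine ⟨⟨j, Motion.inflate σ.factor S.pos * φ⟩, ?_, rfl⟩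
    simp only [iter, Function.iterate_succ_apply'] at hS ⊢
    exact mem_biUnion hS ⟨φ, hφ, rfl⟩

/-- For a primitive substitution, some supertiles of positive level contain tiles of all kinds. -/
theorem exists_mem_level_kind [Fintype ι] [DecidableEq ι] (hprim : σ.matrix.IsPrimitive) :
    ∃ p > 0, ∀ (T : Tile ι) (j : ι), ∃ S ∈ σ.level p T, S.kind = j := by
  classical
  obtain ⟨p, hp, h⟩ := hprim.exists_pos_pow
  refine ⟨p, hp, fun T j => ?_⟩
  obtain ⟨S, hS, hj⟩ := exists_mem_iter_of_pow_ne_zero p T.kind j (h _ _).ne'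
  rw [← T.move_protoTile, level_move]
  exact ⟨_, Finset.mem_image_of_mem _ (σ.mem_level.2 hS), hj⟩

theorem rotatedPair_level_of_kind_eq [Finite ι] {u : Circle} {n : ℕ} {S T : Tile ι}
    (hST : S.kind = T.kind) (h : RotatedPair u (σ.level n S : Set (Tile ι))) :
    RotatedPair u (σ.level n T : Set (Tile ι)) := by
  classical
  have hT : T = S.move (T.pos * S.pos⁻¹) := Tile.ext hST.symm (by simp)
  rw [hT, level_move, Finset.coe_image]
  exact h.move _

variable (σ) in
-- Inflation does not change linear parts, so a rotation of `T` rotates every tile of its supertile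
-- by the same `u`. Equivariance persists, and the contraction can be iterated.
theorem isEquivariant_sum_level [Finite ι] {k : ℤ} {F : Tile ι → ℂ} (hF : IsEquivariant k F)
    (n : ℕ) : IsEquivariant k fun T => ∑ S ∈ σ.level n T, F S := by
  classical
  intro g u T hg
  simp only
  rw [level_move, Finset.sum_image (Tile.move_injective _).injOn, Finset.mul_sum]
  refine Finset.sum_congr rfl fun S _ => hF _ _ _ ?_
  rw [Motion.linear_iterate_inflate, hg]

/-- Every supertile of some fixed level contains a pair of tiles of the same kind which differ by
a rotation with nontrivial `k`-th power. -/
theorem exists_rotatedPair_level [Fintype ι] [DecidableEq ι] (hprim : σ.matrix.IsPrimitive)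
    {𝒯 : Set (Tile ι)} (h𝒯 : 𝒯 ∈ σ.tilingSpace) (hpin : IsPinwheelLike 𝒯) {k : ℤ} (hk : k ≠ 0) :
    ∃ (n : ℕ) (u : Circle), u ^ k ≠ 1 ∧
      ∀ T : Tile ι, RotatedPair u (σ.level n T : Set (Tile ι)) := by
  classical
  obtain ⟨u, hu, S, hS, h, hh, hS'⟩ := hpin.exists_rotatedPair hk
  obtain ⟨n, i, g, hsub⟩ := h𝒯.2 {S, S.move h} (by simp [insert_subset_iff, hS, hS'])
    (toFinite _)
  have hpair : RotatedPair u ({S, S.move h} : Set (Tile ι)) := ⟨S, by simp, h, hh, by simp⟩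
  have hn : RotatedPair u (σ.level n (protoTile i) : Set (Tile ι)) := by
    rw [coe_level]
    exact (hpair.move g).mono hsub
  obtain ⟨p, -, hp⟩ := exists_mem_level_kind hprim
  refine ⟨n + p, u, hu, fun T => ?_⟩
  obtain ⟨A, hA, hAi⟩ := hp T i
  refine (rotatedPair_level_of_kind_eq (T := A) hAi.symm hn).mono ?_
  rw [level_add]
  exact Finset.coe_subset.2 (Finset.subset_biUnion_of_mem (σ.level n) hA)

namespace IsSelfSimilar

/-- Rotated pairs in supertiles make the passage to sums over supertiles a contraction. -/
theorem exists_contraction (hσ : σ.IsSelfSimilar) [Finite ι] {k : ℤ} {n : ℕ} {u : Circle}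
    (hu : u ^ k ≠ 1)
    (hpair : ∀ T : Tile ι, RotatedPair u (σ.level n T : Set (Tile ι))) :
    ∃ δ : ℝ, 0 ≤ δ ∧ δ < 1 ∧ ∀ (F : Tile ι → ℂ) (c : ℝ), IsEquivariant k F → 0 ≤ c →
      (∀ T, ‖F T‖ ≤ c * σ.innerArea T) →
      ∀ T, ‖∑ S ∈ σ.level n T, F S‖ ≤ δ * (σ.factor ^ n) ^ 2 * c * σ.innerArea T := by
  classical
  obtain ⟨b, hb, hb'⟩ := σ.exists_innerArea_ge
  obtain ⟨a, ha, ha'⟩ := σ.exists_area_le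
  -- The pair saves at least `η` times the bound for one of its tiles; `θ` is a lower bound, uniform
  -- in `T`, for this saving relative to the inflated inner area of `T`.
  set η := 2 - ‖1 + ((u ^ k : Circle) : ℂ)‖ with hη
  have hη0 : 0 < η := sub_pos.2 (norm_one_add_lt_two hu)
  have hΛ : 0 < (σ.factor ^ n) ^ 2 := pow_pos (pow_pos hσ.factor_pos n) 2
  set θ := η * b / ((σ.factor ^ n) ^ 2 * a) with hθ
  have hθ0 : 0 < θ := by positivity
  -- The truncation at `0` makes `δ` nonnegative, as needed for its powers, without a proof that `θ
  -- ≤ 1`.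
  refine ⟨max 0 (1 - θ), le_max_left _ _, max_lt one_pos (by linarith), ?_⟩
  intro F c hF hc hFc T
  obtain ⟨S, hS, h, hh, hS'⟩ := hpair T
  rw [Finset.mem_coe] at hS hS'
  have hne : S ≠ S.move h := by
    intro heq
    have h1 : h = 1 := by
      have := congrArg Tile.pos heq
      simpa using this.symm
    refine hu ?_
    have h2 : rotation u 1 = 1 := by rw [← hh, h1]; rfl
    rw [rotation_apply, mul_one] at h2
    rw [Circle.ext (h2.trans Circle.coe_one.symm), one_zpow]
  have hsub : ({S, S.move h} : Finset (Tile ι)) ⊆ σ.level n T := by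
    simp [Finset.insert_subset_iff, hS, hS']
  have hsplit := Finset.sum_sdiff (f := F) hsub
  have hsplit' := Finset.sum_sdiff (f := σ.innerArea) hsub
  rw [Finset.sum_pair hne] at hsplit hsplit'
  rw [innerArea_move] at hsplit'
  have h1 : ‖∑ A ∈ σ.level n T \ {S, S.move h}, F A‖ ≤
      c * ∑ A ∈ σ.level n T \ {S, S.move h}, σ.innerArea A := by
    rw [Finset.mul_sum]
    exact norm_sum_le_of_le _ fun A _ => hFc A
  have h2 : ‖F S + F (S.move h)‖ ≤ (2 - η) * (c * σ.innerArea S) := by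
    rw [hF h u S hh, ← one_add_mul, norm_mul, hη, sub_sub_cancel]
    exact mul_le_mul_of_nonneg_left (hFc S) (norm_nonneg _)
  have h3 := hσ.sum_innerArea_level_le n T
  have h4 : θ * ((σ.factor ^ n) ^ 2 * σ.innerArea T) ≤ η * σ.innerArea S := by
    calc θ * ((σ.factor ^ n) ^ 2 * σ.innerArea T) ≤ θ * ((σ.factor ^ n) ^ 2 * a) := by
          gcongr
          exact (σ.innerArea_le_area T).trans (ha' T)
      _ = η * b := by rw [hθ, div_mul_cancel₀ _ (mul_pos hΛ ha).ne']
      _ ≤ η * σ.innerArea S := by gcongr; exact hb' S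
  have hT0 := σ.innerArea_pos T
  calc ‖∑ A ∈ σ.level n T, F A‖
      ≤ c * ∑ A ∈ σ.level n T \ {S, S.move h}, σ.innerArea A + (2 - η) * (c * σ.innerArea S) := by
        rw [← hsplit]
        exact (norm_add_le _ _).trans (add_le_add h1 h2)
    _ = c * (∑ A ∈ σ.level n T, σ.innerArea A - η * σ.innerArea S) := by rw [← hsplit']; ring
    _ ≤ c * ((σ.factor ^ n) ^ 2 * σ.innerArea T
          - θ * ((σ.factor ^ n) ^ 2 * σ.innerArea T)) := by gcongr
    _ = (1 - θ) * ((σ.factor ^ n) ^ 2 * c * σ.innerArea T) := by ring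
    _ ≤ max 0 (1 - θ) * ((σ.factor ^ n) ^ 2 * c * σ.innerArea T) := by
        gcongr
        exact le_max_right _ _
    _ = _ := by ring

/-- The one-step bound `h` holds for all equivariant functions, so it applies again to the sums
themselves, with `q * c` in place of `c`. -/
theorem norm_sum_level_mul_le (hσ : σ.IsSelfSimilar) [Finite ι] {k : ℤ} {n : ℕ} {q : ℝ} (hq : 0 ≤ q)
    (h : ∀ (F : Tile ι → ℂ) (c : ℝ), IsEquivariant k F → 0 ≤ c →
      (∀ T, ‖F T‖ ≤ c * σ.innerArea T) →
      ∀ T, ‖∑ S ∈ σ.level n T, F S‖ ≤ q * c * σ.innerArea T) (l : ℕ)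
    {F : Tile ι → ℂ} {c : ℝ} (hF : IsEquivariant k F) (hc : 0 ≤ c)
    (hFc : ∀ T, ‖F T‖ ≤ c * σ.innerArea T) (T : Tile ι) :
    ‖∑ S ∈ σ.level (n * l) T, F S‖ ≤ q ^ l * c * σ.innerArea T := by
  induction l generalizing F c with
  | zero => simpa [level_zero] using hFc T
  | succ l ih =>
    rw [Nat.mul_succ, add_comm, hσ.sum_level_add]
    refine (ih (σ.isEquivariant_sum_level hF n) (mul_nonneg hq hc) (h F c hF hc hFc)).trans_eq ?_
    ring

theorem exists_card_level_ge (hσ : σ.IsSelfSimilar) [Finite ι] : ∃ a > 0, ∀ (n : ℕ) (T : Tile ι),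
    (σ.factor ^ n) ^ 2 * σ.innerArea T ≤ a * (σ.level n T).card := by
  obtain ⟨a, ha, ha'⟩ := σ.exists_area_le
  refine ⟨a, ha, fun n T => ?_⟩
  calc (σ.factor ^ n) ^ 2 * σ.innerArea T ≤ (σ.factor ^ n) ^ 2 * σ.area T := by
        gcongr
        exact σ.innerArea_le_area T
    _ ≤ ∑ S ∈ σ.level n T, σ.area S := hσ.le_sum_area_level n T
    _ ≤ ∑ S ∈ σ.level n T, a := Finset.sum_le_sum fun S _ => ha' S
    _ = a * (σ.level n T).card := by rw [Finset.sum_const, nsmul_eq_mul, mul_comm]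

/-- The exponential sums of the orientations over supertiles of large level are small. -/
theorem exists_norm_sum_level_le (hσ : σ.IsSelfSimilar) [Fintype ι] [DecidableEq ι]
    (hprim : σ.matrix.IsPrimitive)
    {𝒯 : Set (Tile ι)} (h𝒯 : 𝒯 ∈ σ.tilingSpace) (hpin : IsPinwheelLike 𝒯) {k : ℤ} (hk : k ≠ 0)
    {ε : ℝ} (hε : 0 < ε) :
    ∃ K : ℕ, ∀ T : Tile ι, ‖∑ S ∈ σ.level K T, S.direction ^ k‖ ≤ ε * (σ.level K T).card := by
  obtain ⟨n, u, hu, hpair⟩ := exists_rotatedPair_level hprim h𝒯 hpin hk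
  obtain ⟨δ, hδ0, hδ1, hδ⟩ := hσ.exists_contraction hu hpair
  obtain ⟨b, hb, hb'⟩ := σ.exists_innerArea_ge
  obtain ⟨a, ha, ha'⟩ := hσ.exists_card_level_ge
  -- The factor `1 / b` compares the unit summands with inner area, and `a` compares inner area with
  -- the number of tiles.
  obtain ⟨l, hl⟩ := exists_pow_lt_of_lt_one (show 0 < ε * b / a by positivity) hδ1
  refine ⟨n * l, fun T => ?_⟩
  have h := hσ.norm_sum_level_mul_le (mul_nonneg hδ0 (sq_nonneg (σ.factor ^ n))) hδ l
    (isEquivariant_direction_zpow k) (inv_nonneg.2 hb.le)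
    (fun T => by
      rw [norm_zpow, Tile.norm_direction, one_zpow]
      exact (le_inv_mul_iff₀ hb).2 (by simpa using hb' T)) T
  have hcard := ha' (n * l) T
  calc _ ≤ _ := h
    _ = δ ^ l * b⁻¹ * ((σ.factor ^ (n * l)) ^ 2 * σ.innerArea T) := by ring
    _ ≤ ε * b / a * b⁻¹ * (a * (σ.level (n * l) T).card) := by
        gcongr
        exact mul_nonneg (sq_nonneg _) (σ.innerArea_pos T).le
    _ = _ := by field_simp

end IsSelfSimilar

/-! ### Patches of tilings -/

/-- In a packing, a tile whose interior is covered by finitely many tiles is one of them. -/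
theorem IsPacking.mem_of_interior_subset {Q : Set (Tile ι)} (hQ : σ.IsPacking Q)
    {F : Finset (Tile ι)} (hF : (F : Set (Tile ι)) ⊆ Q) {S : Tile ι} (hS : S ∈ Q)
    (hcov : interior (σ.support S) ⊆ ⋃ T ∈ F, σ.support T) : S ∈ F := by
  by_contra hSF
  -- Baire category: finitely many closed sets cover the plane, so the union of their interiors is
  -- dense and meets the interior of `S`. This works for boundaries of positive area too.
  let f : Option F → Set ℂ := fun o => o.elim (interior (σ.support S))ᶜ fun T => σ.support T
  have hc : ∀ o, IsClosed (f o) := by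
    rintro (_ | T)
    · exact isOpen_interior.isClosed_compl
    · exact (σ.isCompact_support T).isClosed
  have hU : ⋃ o, f o = univ := by
    refine eq_univ_of_forall fun z => ?_
    by_cases hz : z ∈ interior (σ.support S)
    · obtain ⟨T, hT, hzT⟩ := mem_iUnion₂.1 (hcov hz)
      exact mem_iUnion.2 ⟨some ⟨T, hT⟩, hzT⟩
    · exact mem_iUnion.2 ⟨none, hz⟩
  obtain ⟨z, hz, hz'⟩ := (dense_iUnion_interior_of_closed hc hU).inter_open_nonempty _
    isOpen_interior (σ.nonempty_interior_support S)
  obtain ⟨o, ho⟩ := mem_iUnion.1 hz'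
  rcases o with _ | T
  · exact interior_subset ho hz
  · exact disjoint_left.1 (hQ hS (hF T.2) fun h => hSF (h ▸ T.2)) hz ho

theorem exists_dist_le [Finite ι] (σ : Substitution ι) :
    ∃ d : ℝ, 0 ≤ d ∧ ∀ T : Tile ι, ∀ x ∈ σ.support T, ∀ y ∈ σ.support T, dist x y ≤ d := by
  obtain ⟨d, hd⟩ := (finite_range fun i => Metric.diam (σ.proto i)).bddAbove
  refine ⟨max d 0, le_max_right _ _, ?_⟩
  rintro T _ ⟨x, hx, rfl⟩ _ ⟨y, hy, rfl⟩
  rw [T.pos.dist_map]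
  exact (Metric.dist_le_diam_of_mem (σ.isCompact_proto _).isBounded hx hy).trans
    ((hd (mem_range_self _)).trans (le_max_left _ _))

/-- The number of tiles of a packing at distance between `R - D` and `R` from the origin grows at
most linearly with `R`. -/
theorem exists_card_annulus_le [Finite ι] (σ : Substitution ι) {D : ℝ} (hD : 0 ≤ D) :
    ∃ C : ℝ, 0 ≤ C ∧ ∃ d : ℝ, 0 ≤ d ∧ ∀ (P : Finset (Tile ι)) (R : ℝ), σ.IsPacking P → 0 ≤ R →
      (∀ T ∈ P, Metric.infDist 0 (σ.support T) ∈ Icc (R - D) R) →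
        (P.card : ℝ) ≤ C * (2 * R + d) := by
  obtain ⟨d, hd, hd'⟩ := σ.exists_dist_le
  obtain ⟨b, hb, hb'⟩ := σ.exists_innerArea_ge
  -- The tiles lie between the radii `ρ` and `R + d`, where `d` bounds their diameters, and each has
  -- inner area at least `b`.
  refine ⟨Real.pi * (D + d) / b, by positivity, d, hd, fun P R hP hR hPR => ?_⟩
  set ρ := max 0 (R - D)
  have hρ0 : 0 ≤ ρ := le_max_left _ _
  have hρ1 : R - D ≤ ρ := le_max_right _ _
  have hρR : ρ ≤ R := max_le hR (by linarith)
  have hvol : volume.real (Metric.closedBall (0 : ℂ) (R + d) \ Metric.ball 0 ρ) =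
      Real.pi * ((R + d) ^ 2 - ρ ^ 2) := by
    rw [measureReal_sdiff ((Metric.ball_subset_closedBall).trans
      (Metric.closedBall_subset_closedBall (by linarith))) measurableSet_ball
      measure_closedBall_lt_top.ne, measureReal_def, measureReal_def, Complex.volume_closedBall,
      Complex.volume_ball]
    simp [ENNReal.toReal_ofReal hρ0, ENNReal.toReal_ofReal (show 0 ≤ R + d by linarith)]
    ring
  have hsum := σ.sum_innerArea_le hP
    (U := Metric.closedBall (0 : ℂ) (R + d) \ Metric.ball 0 ρ)
    (measure_ne_top_of_subset sdiff_subset measure_closedBall_lt_top.ne) (by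
      intro T hT z hz
      have hz := interior_subset hz
      obtain ⟨h1, h2⟩ := hPR T hT
      have h3 := Metric.infDist_le_dist_of_mem (x := (0 : ℂ)) hz
      obtain ⟨w, hw, hw'⟩ := (σ.isCompact_support T).exists_infDist_eq_dist
        (σ.nonempty_support T) (0 : ℂ)
      have h4 := hd' T z hz w hw
      have h5 := dist_triangle z w 0
      rw [dist_comm w 0] at h5
      rw [dist_comm] at h3
      simp only [Set.mem_sdiff, Metric.mem_closedBall, Metric.mem_ball, not_lt]
      exact ⟨by linarith, max_le dist_nonneg (by linarith)⟩)
  rw [hvol] at hsum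
  have hcard : (P.card : ℝ) * b ≤ ∑ T ∈ P, σ.innerArea T := by
    rw [← nsmul_eq_mul]
    exact Finset.card_nsmul_le_sum _ _ _ fun T _ => hb' T
  have hsq : (R + d) ^ 2 - ρ ^ 2 ≤ (D + d) * (2 * R + d) := by
    rw [sq_sub_sq, mul_comm]
    exact mul_le_mul (by linarith) (by linarith) (by linarith) (by linarith)
  rw [div_mul_eq_mul_div, le_div_iff₀ hb]
  calc (P.card : ℝ) * b ≤ Real.pi * ((R + d) ^ 2 - ρ ^ 2) := hcard.trans hsum
    _ ≤ Real.pi * ((D + d) * (2 * R + d)) := by gcongr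
    _ = _ := by ring

theorem level_subset_level_add [Finite ι] {p : ℕ} {S T : Tile ι} (h : S ∈ σ.level p T) (n : ℕ) :
    σ.level n S ⊆ σ.level (n + p) T := by
  classical
  rw [level_add]
  exact Finset.subset_biUnion_of_mem (σ.level n) h

namespace IsSelfSimilar

/-- Some tile of the level-`p` supertile of `A` has the kind of `A`; moving `A` suitably carries
that tile onto `A`. Hence every tile lies in supertiles of higher and higher level. -/
theorem exists_mem_level_mul (hσ : σ.IsSelfSimilar) [Fintype ι] [DecidableEq ι] {p : ℕ}
    (hp : ∀ (T : Tile ι) (j : ι), ∃ S ∈ σ.level p T, S.kind = j) (q : ℕ) (T : Tile ι) :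
    ∃ A, T ∈ σ.level (p * q) A := by
  classical
  induction q with
  | zero => exact ⟨T, by simp [level_zero]⟩
  | succ q ih =>
    obtain ⟨A, hA⟩ := ih
    obtain ⟨S, hS, hSA⟩ := hp A A.kind
    obtain ⟨g, hg⟩ := (Motion.inflate_surjective hσ.factor_ne_zero).iterate p (A.pos * S.pos⁻¹)
    refine ⟨A.move g, ?_⟩
    rw [Nat.mul_succ]
    refine level_subset_level_add (S := A) ?_ _ hA
    rw [level_move, hg]
    exact Finset.mem_image.2 ⟨S, hS, Tile.ext hSA (by simp)⟩

/-- The patches of a tiling in the tiling space lie in supertiles of arbitrarily large level. -/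
theorem exists_subset_level (hσ : σ.IsSelfSimilar) [Fintype ι] [DecidableEq ι]
    (hprim : σ.matrix.IsPrimitive)
    {𝒯 : Set (Tile ι)} (h𝒯 : 𝒯 ∈ σ.tilingSpace) {F : Finset (Tile ι)}
    (hF : (F : Set (Tile ι)) ⊆ 𝒯) (K : ℕ) : ∃ (m : ℕ) (T : Tile ι), F ⊆ σ.level (K + m) T := by
  obtain ⟨n, i, g, hsub⟩ := h𝒯.2 F hF F.finite_toSet
  obtain ⟨T, hT⟩ := σ.exists_move_supertile_eq hσ.factor_ne_zero n i g⁻¹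
  have hFT : F ⊆ σ.level n T := by
    rw [← Finset.coe_subset, ← hT]
    intro S hS
    exact ⟨S.move g, hsub (mem_image_of_mem _ hS), by
      rw [Tile.move_move, inv_mul_cancel, Tile.move_one]⟩
  obtain ⟨p, hp, hp'⟩ := exists_mem_level_kind hprim
  obtain ⟨A, hA⟩ := hσ.exists_mem_level_mul hp' K T
  obtain ⟨m, hm⟩ := Nat.exists_eq_add_of_le
    (show K ≤ n + p * K from (Nat.le_mul_of_pos_left K hp).trans (Nat.le_add_left _ _))
  exact ⟨m, A, hm ▸ hFT.trans (level_subset_level_add hA n)⟩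

theorem dist_le_of_mem_level (hσ : σ.IsSelfSimilar) [Finite ι] {d : ℝ}
    (hd : ∀ T : Tile ι, ∀ x ∈ σ.support T, ∀ y ∈ σ.support T, dist x y ≤ d) {n : ℕ}
    {A B T : Tile ι} (hA : A ∈ σ.level n T) (hB : B ∈ σ.level n T) {x y : ℂ}
    (hx : x ∈ σ.support A) (hy : y ∈ σ.support B) : dist x y ≤ σ.factor ^ n * d := by
  obtain ⟨x, hxT, rfl⟩ := hσ.support_subset_of_mem_iter (σ.mem_level.1 hA) hx
  obtain ⟨y, hyT, rfl⟩ := hσ.support_subset_of_mem_iter (σ.mem_level.1 hB) hy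
  have h0 : 0 ≤ σ.factor ^ n := pow_nonneg hσ.factor_pos.le n
  simp only [dist_smul₀, Real.norm_of_nonneg h0]
  exact mul_le_mul_of_nonneg_left (hd T x hxT y hyT) h0

/-! ### Exponential sums along enumerations of the tiles -/

section ExponentialSums

variable [Finite ι] {f : Tile ι → ℂ} {ε : ℝ} {K : ℕ}

/-- An estimate for sums over supertiles of one level passes to disjoint unions of supertiles. -/
theorem norm_sum_biUnion_level_le (hσ : σ.IsSelfSimilar) [DecidableEq (Tile ι)]
    (hK : ∀ T, ‖∑ S ∈ σ.level K T, f S‖ ≤ ε * (σ.level K T).card) {m : ℕ} {T : Tile ι}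
    {P : Finset (Tile ι)} (hP : P ⊆ σ.level m T) :
    ‖∑ S ∈ P.biUnion (σ.level K), f S‖ ≤ ε * (P.biUnion (σ.level K)).card := by
  have hd : (P : Set (Tile ι)).PairwiseDisjoint (σ.level K) :=
    (hσ.pairwiseDisjoint_level K m T).subset (Finset.coe_subset.2 hP)
  rw [Finset.sum_biUnion hd, Finset.card_biUnion hd, Nat.cast_sum, Finset.mul_sum]
  exact norm_sum_le_of_le _ fun A _ => hK A

theorem norm_sum_level_le_of_le (hσ : σ.IsSelfSimilar)
    (hK : ∀ T, ‖∑ S ∈ σ.level K T, f S‖ ≤ ε * (σ.level K T).card) {n : ℕ} (hn : K ≤ n)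
    (T : Tile ι) : ‖∑ S ∈ σ.level n T, f S‖ ≤ ε * (σ.level n T).card := by
  classical
  obtain ⟨m, rfl⟩ := Nat.exists_eq_add_of_le hn
  rw [level_add]
  exact hσ.norm_sum_biUnion_level_le hK subset_rfl

/-- A patch inside a supertile consists of complete supertiles of lower level and of tiles in
supertiles which are not contained in the patch. -/
theorem exists_subset_norm_sum_le (hσ : σ.IsSelfSimilar)
    (hK : ∀ T, ‖∑ S ∈ σ.level K T, f S‖ ≤ ε * (σ.level K T).card) {m : ℕ} {T : Tile ι}
    {F : Finset (Tile ι)} (hF : F ⊆ σ.level (K + m) T) :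
    ∃ G ⊆ F, ‖∑ S ∈ G, f S‖ ≤ ε * G.card ∧ ∀ S ∈ F, S ∉ G → ∃ A, S ∈ σ.level K A ∧
      σ.level K A ⊆ σ.level (K + m) T ∧ ¬ σ.level K A ⊆ F := by
  classical
  refine ⟨((σ.level m T).filter fun A => σ.level K A ⊆ F).biUnion (σ.level K), ?_,
    hσ.norm_sum_biUnion_level_le hK (Finset.filter_subset _ _), ?_⟩
  · exact Finset.biUnion_subset.2 fun A hA => (Finset.mem_filter.1 hA).2
  · intro S hS hSG
    have hS' := hF hS
    rw [level_add, Finset.mem_biUnion] at hS'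
    obtain ⟨A, hA, hSA⟩ := hS'
    refine ⟨A, hSA, level_subset_level_add hA K, fun hAF => hSG ?_⟩
    exact Finset.mem_biUnion.2 ⟨A, Finset.mem_filter.2 ⟨hA, hAF⟩, hSA⟩

end ExponentialSums

/-- Supertiles of level below `K` have boundedly many tiles, so for large `n` only levels at least
`K` occur, where the uniform bound applies. -/
theorem tendsto_mean_along_supertiles (hσ : σ.IsSelfSimilar) [Fintype ι] {f : Tile ι → ℂ}
    (hf : ∀ ε > 0, ∃ K, ∀ T, ‖∑ S ∈ σ.level K T, f S‖ ≤ ε * (σ.level K T).card)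
    {s : ℕ → Tile ι} (hs : Function.Injective s) :
    Tendsto (fun n : ℕ => (∑ j ∈ Finset.range n, f (s j)) / n)
      (atTop ⊓ 𝓟 {n | σ.IsSupertile (s '' Iio n)}) (𝓝 0) := by
  classical
  rw [Metric.tendsto_nhds]
  intro ε hε
  obtain ⟨K, hK⟩ := hf (ε / 2) (half_pos hε)
  let M := ∑ k ∈ Finset.range K, ∑ i : ι, (σ.level k (protoTile i)).card
  rw [eventually_inf_principal]
  filter_upwards [eventually_gt_atTop M] with n hn hsup
  obtain ⟨k, i, g, hsup⟩ := hsup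
  obtain ⟨T, hT⟩ := σ.exists_move_supertile_eq hσ.factor_ne_zero k i g
  have himg : (Finset.range n).image s = σ.level k T := by
    rw [← Finset.coe_inj, Finset.coe_image, Finset.coe_range, hsup, hT]
  have hcard : (σ.level k T).card = n := by
    rw [← himg, Finset.card_image_of_injective _ hs, Finset.card_range]
  have hkK : K ≤ k := by
    by_contra! hlt
    have h1 : (σ.level k (protoTile T.kind)).card ≤ ∑ i : ι, (σ.level k (protoTile i)).card :=
      Finset.single_le_sum (f := fun i => (σ.level k (protoTile i)).card)
        (fun _ _ => Nat.zero_le _) (Finset.mem_univ T.kind)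
    have h2 : ∑ i : ι, (σ.level k (protoTile i)).card ≤ M :=
      Finset.single_le_sum (f := fun k => ∑ i : ι, (σ.level k (protoTile i)).card)
        (fun _ _ => Nat.zero_le _) (Finset.mem_range.2 hlt)
    rw [← card_level, hcard] at h1
    omega
  have hsum := hσ.norm_sum_level_le_of_le hK hkK T
  rw [hcard, ← himg, Finset.sum_image hs.injOn] at hsum
  have hn0 : (0 : ℝ) < n := Nat.cast_pos.2 (Nat.zero_lt_of_lt hn)
  rw [dist_zero_right, norm_div, Complex.norm_natCast, div_lt_iff₀ hn0]
  nlinarith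

/-- The first `n` tiles cover the open disc whose radius `R` is the distance of the next tile. All
incomplete supertiles of level `K` therefore contribute only tiles from an annulus of fixed width
`D`. -/
theorem tendsto_mean_by_distance (hσ : σ.IsSelfSimilar) [Fintype ι] [DecidableEq ι]
    (hprim : σ.matrix.IsPrimitive)
    {f : Tile ι → ℂ} (hf1 : ∀ T, ‖f T‖ ≤ 1)
    (hf : ∀ ε > 0, ∃ K, ∀ T, ‖∑ S ∈ σ.level K T, f S‖ ≤ ε * (σ.level K T).card)
    {𝒯 : Set (Tile ι)} (h𝒯 : 𝒯 ∈ σ.tilingSpace) {s : ℕ → Tile ι}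
    (hs : σ.IsOrderedByDistance 𝒯 s) :
    Tendsto (fun n : ℕ => (∑ j ∈ Finset.range n, f (s j)) / n) atTop (𝓝 0) := by
  classical
  obtain ⟨hbij, hmono⟩ := hs
  have hinj : Function.Injective s := injOn_univ.1 hbij.injOn
  obtain ⟨d, hd0, hd⟩ := σ.exists_dist_le
  obtain ⟨a, ha, ha'⟩ := σ.exists_area_le
  rw [Metric.tendsto_nhds]
  intro ε hε
  obtain ⟨K, hK⟩ := hf (ε / 4) (by positivity)
  set D := σ.factor ^ K * d with hD
  have hD0 : 0 ≤ D := mul_nonneg (pow_nonneg hσ.factor_pos.le K) hd0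
  obtain ⟨C, hC, e, he, hcount⟩ := σ.exists_card_annulus_le hD0
  filter_upwards [eventually_gt_atTop 0,
    tendsto_natCast_atTop_atTop.eventually_gt_atTop ((4 * a * C ^ 2 / ε + C * e) / (ε / 2))]
    with n hn hnlarge
  have hn0 : (0 : ℝ) < n := Nat.cast_pos.2 hn
  set F := (Finset.range n).image s with hFdef
  set R := Metric.infDist 0 (σ.support (s n)) with hR
  have hR0 : 0 ≤ R := Metric.infDist_nonneg
  have hFcard : F.card = n := by rw [Finset.card_image_of_injective _ hinj, Finset.card_range]
  have hF𝒯 : (F : Set (Tile ι)) ⊆ 𝒯 := by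
    rw [hFdef, Finset.coe_image]
    exact (image_mono (subset_univ _)).trans hbij.image_eq.subset
  have hFR : ∀ T ∈ F, Metric.infDist 0 (σ.support T) ≤ R := by
    intro T hT
    obtain ⟨j, hj, rfl⟩ := Finset.mem_image.1 hT
    exact hmono (Finset.mem_range.1 hj).le
  have hcov : Metric.ball (0 : ℂ) R ⊆ ⋃ T ∈ F, σ.support T := by
    intro z hz
    obtain ⟨T, hT, hzT⟩ := mem_iUnion₂.1 (h𝒯.1.covers.symm.subset (mem_univ z))
    obtain ⟨j, -, rfl⟩ := hbij.surjOn hT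
    refine mem_biUnion (Finset.mem_coe.2 (Finset.mem_image_of_mem s (Finset.mem_range.2 ?_))) hzT
    by_contra! hle
    have h1 : R ≤ Metric.infDist 0 (σ.support (s j)) := hmono hle
    have h2 := Metric.infDist_le_dist_of_mem (x := (0 : ℂ)) hzT
    rw [Metric.mem_ball, dist_comm] at hz
    linarith
  -- The disc of area `π R²` is covered by `n` tiles of area at most `a`.
  have hR2 : R ^ 2 ≤ a * n := by
    have h1 := σ.le_sum_area hcov
    have h2 : ∑ T ∈ F, σ.area T ≤ n * a := by
      rw [← hFcard, ← nsmul_eq_mul]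
      exact Finset.sum_le_card_nsmul _ _ _ fun T _ => ha' T
    rw [measureReal_def, Complex.volume_ball] at h1
    simp only [ENNReal.toReal_mul, ENNReal.toReal_pow, ENNReal.toReal_ofReal hR0] at h1
    have h3 : R ^ 2 * 1 ≤ R ^ 2 * Real.pi := by
      gcongr
      linarith [Real.pi_gt_three]
    have h4 : ((NNReal.pi : ENNReal)).toReal = Real.pi := rfl
    rw [h4] at h1
    linarith
  obtain ⟨m, T₀, hFT⟩ := hσ.exists_subset_level hprim h𝒯 hF𝒯 K
  obtain ⟨G, hGF, hG, hrest⟩ := hσ.exists_subset_norm_sum_le hK hFT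
  have hpack := hσ.isPacking_level (K + m) T₀
  -- A tile closer than `R - D` has its whole level-`K` supertile inside the disc, hence covered by
  -- `F`. The missing tile `B` is not known to belong to `𝒯`, so the packing used is the large
  -- supertile containing both `F` and `B`.
  have hannulus : ∀ S ∈ F \ G, Metric.infDist 0 (σ.support S) ∈ Icc (R - D) R := by
    intro S hS
    obtain ⟨hSF, hSG⟩ := Finset.mem_sdiff.1 hS
    refine ⟨?_, hFR S hSF⟩
    obtain ⟨A, hSA, hAsub, hAF⟩ := hrest S hSF hSG
    obtain ⟨B, hBA, hBF⟩ := Finset.not_subset.1 hAF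
    by_contra! hlt
    obtain ⟨w, hw, hw'⟩ := (σ.isCompact_support S).exists_infDist_eq_dist
      (σ.nonempty_support S) (0 : ℂ)
    refine hBF (hpack.mem_of_interior_subset (Finset.coe_subset.2 hFT) (hAsub hBA) ?_)
    refine Subset.trans (fun z hz => ?_) hcov
    have h1 := hσ.dist_le_of_mem_level hd hBA hSA (interior_subset hz) hw
    have h2 := dist_triangle z w 0
    rw [dist_comm w 0] at h2
    rw [Metric.mem_ball]
    linarith
  have hFG := hcount (F \ G) R (hpack.mono (Finset.coe_subset.2 (Finset.sdiff_subset.trans hFT)))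
    hR0 hannulus
  have hsumF : ‖∑ S ∈ F, f S‖ ≤ C * (2 * R + e) + ε / 4 * n := by
    rw [← Finset.sum_sdiff hGF]
    refine (norm_add_le _ _).trans (add_le_add ?_ (hG.trans ?_))
    · refine (norm_sum_le_of_le _ fun S _ => hf1 S).trans ?_
      simpa using hFG
    · gcongr
      exact_mod_cast (Finset.card_le_card hGF).trans_eq hFcard
  rw [hFdef, Finset.sum_image hinj.injOn] at hsumF
  rw [div_lt_iff₀ (by positivity)] at hnlarge
  -- The inequality of arithmetic and geometric means, weighted so that the term in `R ^ 2` costs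
  -- only `ε / 4 * n`.
  have hamgm : 2 * C * R ≤ ε / 4 * n + 4 * a * C ^ 2 / ε := by
    have h1 : ε / (4 * a) * R ^ 2 ≤ ε / 4 * n := by
      calc ε / (4 * a) * R ^ 2 ≤ ε / (4 * a) * (a * n) := by gcongr
        _ = ε / 4 * n := by field_simp
    have h2 : ε / (4 * a) * R ^ 2 + 4 * a * C ^ 2 / ε - 2 * C * R =
        ε / (4 * a) * (R - 4 * a * C / ε) ^ 2 := by
      field_simp
      ring
    have h3 : 0 ≤ ε / (4 * a) * (R - 4 * a * C / ε) ^ 2 := by positivity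
    linarith
  rw [dist_zero_right, norm_div, Complex.norm_natCast, div_lt_iff₀ hn0]
  linarith

end IsSelfSimilar

end Substitution

end PlaneTiling

/-! ### Weyl's criterion -/

namespace AddCircle

variable {T : ℝ}

/-- The uniform distribution on the first `n` terms of a sequence (on the first term if `n = 0`). -/
def empiricalMeasure (x : ℕ → AddCircle T) (n : ℕ) : Measure (AddCircle T) :=
  ((max n 1 : ℕ) : ENNReal)⁻¹ • ∑ j ∈ Finset.range (max n 1), Measure.dirac (x j)

instance (x : ℕ → AddCircle T) (n : ℕ) : IsProbabilityMeasure (empiricalMeasure x n) where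
  measure_univ := by
    have h : ((max n 1 : ℕ) : ENNReal) ≠ 0 := Nat.cast_ne_zero.2 (by omega)
    simp only [empiricalMeasure, Measure.smul_apply, Measure.finsetSum_apply, measure_univ,
      Finset.sum_const, Finset.card_range, nsmul_eq_mul, mul_one, smul_eq_mul]
    exact ENNReal.inv_mul_cancel h (ENNReal.natCast_ne_top _)

theorem integral_empiricalMeasure (x : ℕ → AddCircle T) {n : ℕ} (hn : 0 < n)
    (f : C(AddCircle T, ℂ)) :
    ∫ t, f t ∂(empiricalMeasure x n) = (∑ j ∈ Finset.range n, f (x j)) / n := by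
  rw [empiricalMeasure, max_eq_left hn, integral_smul_measure, integral_finsetSum_measure]
  · simp [div_eq_inv_mul]
  · exact fun j _ => integrable_dirac (by finiteness)

open Classical in
theorem empiricalMeasure_real_apply (x : ℕ → AddCircle T) {n : ℕ} (hn : 0 < n)
    {s : Set (AddCircle T)} (hs : MeasurableSet s) :
    (empiricalMeasure x n).real s = (((Finset.range n).filter fun j => x j ∈ s).card : ℝ) / n := by
  rw [measureReal_def, empiricalMeasure, max_eq_left hn, Measure.smul_apply,
    Measure.finsetSum_apply]
  simp only [Measure.dirac_apply' _ hs, indicator_apply, Pi.one_apply, Finset.sum_boole,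
    smul_eq_mul, ENNReal.toReal_mul, ENNReal.toReal_inv, ENNReal.toReal_natCast]
  rw [div_eq_inv_mul]

theorem isClosed_image_Icc {x y : ℝ} : IsClosed (((↑) : ℝ → AddCircle T) '' Icc x y) :=
  (isCompact_Icc.image (AddCircle.continuous_mk' T)).isClosed

/-- The quotient map is open, so the image of the open interval lies in the interior. -/
theorem frontier_image_Icc_subset {x y : ℝ} :
    frontier (((↑) : ℝ → AddCircle T) '' Icc x y) ⊆ {(x : AddCircle T), (y : AddCircle T)} := by
  rw [isClosed_image_Icc.frontier_eq]
  rintro _ ⟨⟨r, hr, rfl⟩, hnot⟩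
  have hopen : IsOpen (((↑) : ℝ → AddCircle T) '' Ioo x y) :=
    QuotientAddGroup.isOpenMap_coe _ isOpen_Ioo
  have hr' : r ∉ Ioo x y := fun h =>
    hnot (interior_maximal (image_mono Ioo_subset_Icc_self) hopen (mem_image_of_mem _ h))
  rcases hr.1.eq_or_lt with rfl | h1
  · exact Or.inl rfl
  · rcases hr.2.eq_or_lt with rfl | h2
    · exact Or.inr rfl
    · exact absurd ⟨h1, h2⟩ hr'

variable [hT : Fact (0 < T)]

theorem integral_fourier (k : ℤ) :
    ∫ t, fourier k t ∂(haarAddCircle : Measure (AddCircle T)) = if k = 0 then 1 else 0 := by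
  have h := congrFun (fourierCoeff_fourier (T := T) k) 0
  rw [fourierCoeff] at h
  simp only [neg_zero, fourier_zero, one_smul] at h
  rw [h]
  by_cases hk : k = 0
  · simp [hk]
  · rw [Pi.single_eq_of_ne (Ne.symm hk), if_neg hk]

/-- If the exponential sums of a sequence are `o(n)`, then the means of continuous functions along
the sequence converge to the integral. -/
theorem tendsto_mean_of_tendsto_mean_fourier {l : Filter ℕ} (hl : l ≤ atTop)
    {x : ℕ → AddCircle T} (h : ∀ k : ℤ, k ≠ 0 →
      Tendsto (fun n : ℕ => (∑ j ∈ Finset.range n, fourier k (x j)) / n) l (𝓝 0))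
    (f : C(AddCircle T, ℂ)) :
    Tendsto (fun n : ℕ => (∑ j ∈ Finset.range n, f (x j)) / n) l
      (𝓝 (∫ t, f t ∂haarAddCircle)) := by
  have hintegrable : ∀ g : C(AddCircle T, ℂ), Integrable g haarAddCircle := fun g =>
    g.continuous.integrable_of_hasCompactSupport (HasCompactSupport.of_compactSpace _)
  -- Trigonometric polynomials follow by linearity; their uniform density in the continuous
  -- functions gives the rest.
  have hspan : ∀ g ∈ Submodule.span ℂ (range (fourier : ℤ → C(AddCircle T, ℂ))),
      Tendsto (fun n : ℕ => (∑ j ∈ Finset.range n, g (x j)) / n) l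
        (𝓝 (∫ t, g t ∂haarAddCircle)) := by
    intro g hg
    induction hg using Submodule.span_induction with
    | mem g hg =>
      obtain ⟨k, rfl⟩ := hg
      rw [integral_fourier]
      split_ifs with hk
      · subst hk
        refine tendsto_const_nhds.congr' ?_
        filter_upwards [hl (eventually_ne_atTop 0)] with n hn
        simp [hn]
      · exact h k hk
    | zero => simpa using tendsto_const_nhds
    | add g g' _ _ ih ih' =>
      simp only [ContinuousMap.add_apply, Finset.sum_add_distrib, add_div]
      rw [integral_add (hintegrable g) (hintegrable g')]
      exact ih.add ih'
    | smul c g _ ih =>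
      simp only [ContinuousMap.smul_apply, smul_eq_mul, ← Finset.mul_sum, mul_div_assoc]
      rw [integral_const_mul]
      exact ih.const_mul c
  rw [Metric.tendsto_nhds]
  intro ε hε
  have hf : f ∈ closure (Submodule.span ℂ (range (fourier : ℤ → C(AddCircle T, ℂ))) : Set _) := by
    rw [← Submodule.topologicalClosure_coe, span_fourier_closure_eq_top]
    trivial
  obtain ⟨g, hg, hfg⟩ := Metric.mem_closure_iff.1 hf (ε / 3) (by positivity)
  have hpt : ∀ t, dist (f t) (g t) ≤ ε / 3 := fun t =>
    (ContinuousMap.dist_apply_le_dist t).trans hfg.le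
  have hI : dist (∫ t, g t ∂haarAddCircle) (∫ t, f t ∂(haarAddCircle : Measure (AddCircle T))) ≤
      ε / 3 := by
    rw [dist_eq_norm, ← integral_sub (hintegrable g) (hintegrable f)]
    refine (norm_integral_le_of_norm_le_const (C := ε / 3) (ae_of_all _ fun t => ?_)).trans ?_
    · rw [← dist_eq_norm, dist_comm]
      exact hpt t
    · simp
  filter_upwards [Metric.tendsto_nhds.1 (hspan g hg) (ε / 3) (by positivity),
    hl (eventually_gt_atTop 0)] with n hn hn0
  have hn0' : (0 : ℝ) < n := Nat.cast_pos.2 hn0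
  have hS : dist ((∑ j ∈ Finset.range n, f (x j)) / n)
      ((∑ j ∈ Finset.range n, g (x j)) / n) ≤ ε / 3 := by
    rw [dist_eq_norm, ← sub_div, ← Finset.sum_sub_distrib, norm_div, Complex.norm_natCast,
      div_le_iff₀ hn0']
    refine (norm_sum_le_of_le _ (f := fun j => f (x j) - g (x j)) (n := fun _ => ε / 3)
      fun j _ => ?_).trans_eq ?_
    · rw [← dist_eq_norm]
      exact hpt _
    · simp [mul_comm]
  have h1 := dist_triangle4 ((∑ j ∈ Finset.range n, f (x j)) / n)
      ((∑ j ∈ Finset.range n, g (x j)) / n) (∫ t, g t ∂haarAddCircle) (∫ t, f t ∂haarAddCircle)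
  linarith

open Classical in
/-- Weyl's criterion: if the exponential sums of a sequence are `o(n)`, then the sequence is
equidistributed with respect to sets with null boundary. -/
theorem tendsto_frequency_of_tendsto_mean_fourier {l : Filter ℕ} (hl : l ≤ atTop)
    {x : ℕ → AddCircle T} (h : ∀ k : ℤ, k ≠ 0 →
      Tendsto (fun n : ℕ => (∑ j ∈ Finset.range n, fourier k (x j)) / n) l (𝓝 0))
    {s : Set (AddCircle T)} (hs : MeasurableSet s) (hs0 : haarAddCircle (frontier s) = 0) :
    Tendsto (fun n : ℕ => (((Finset.range n).filter fun j => x j ∈ s).card : ℝ) / n) l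
      (𝓝 (haarAddCircle.real s)) := by
  let μ : ℕ → ProbabilityMeasure (AddCircle T) := fun n => ⟨empiricalMeasure x n, inferInstance⟩
  let ν : ProbabilityMeasure (AddCircle T) := ⟨haarAddCircle, inferInstance⟩
  -- Weak convergence of the empirical measures; the portmanteau theorem then passes to sets with
  -- null frontier.
  have hlim : Tendsto μ l (𝓝 ν) := by
    rw [ProbabilityMeasure.tendsto_iff_forall_integral_rclike_tendsto ℂ]
    intro f
    refine (tendsto_mean_of_tendsto_mean_fourier hl h f.toContinuousMap).congr' ?_
    filter_upwards [hl (eventually_gt_atTop 0)] with n hn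
    exact (integral_empiricalMeasure x hn f.toContinuousMap).symm
  have hlim' := ProbabilityMeasure.tendsto_measure_of_null_frontier_of_tendsto' (μ := ν) hlim hs0
  have hreal := (ENNReal.tendsto_toReal (measure_ne_top haarAddCircle s)).comp hlim'
  refine hreal.congr' ?_
  filter_upwards [hl (eventually_gt_atTop 0)] with n hn
  rw [← empiricalMeasure_real_apply x hn hs]
  rfl

section Arc

variable {x y : ℝ}

theorem coe_mem_image_Icc_iff (hx : 0 ≤ x) (hy : y < T) {t : ℝ} (ht : t ∈ Ico 0 T) :
    (t : AddCircle T) ∈ ((↑) : ℝ → AddCircle T) '' Icc x y ↔ t ∈ Icc x y := by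
  refine ⟨?_, fun h => mem_image_of_mem _ h⟩
  rintro ⟨r, hr, hrt⟩
  have hr' : r ∈ Ico 0 T := ⟨hx.trans hr.1, hr.2.trans_lt hy⟩
  rwa [← (coe_eq_coe_iff_of_mem_Ico (a := 0) (by simpa using hr') (by simpa using ht)).1 hrt]

theorem haarAddCircle_real_image_Icc (hx : 0 ≤ x) (hxy : x ≤ y) (hy : y < T) :
    haarAddCircle.real (((↑) : ℝ → AddCircle T) '' Icc x y) = (y - x) / T := by
  have hT0 := hT.out
  have hvol : volume (((↑) : ℝ → AddCircle T) '' Icc x y) = ENNReal.ofReal (y - x) := by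
    rw [add_projection_respects_measure T 0 isClosed_image_Icc.measurableSet, zero_add,
      ← Real.volume_Icc]
    refine measure_congr ?_
    -- The measure on the circle is computed on `(0, T]`, whereas representatives are taken in `[0,
    -- T)`; the endpoints are null.
    have h0 : ∀ᵐ t : ℝ, t ≠ 0 := by simp [ae_iff]
    have h1 : ∀ᵐ t : ℝ, t ≠ T := by simp [ae_iff]
    filter_upwards [h0, h1] with t h0 h1
    refine propext ⟨fun ⟨h, h'⟩ => ?_, fun h => ⟨mem_image_of_mem _ h, ?_, ?_⟩⟩
    · exact (coe_mem_image_Icc_iff hx hy ⟨h'.1.le, lt_of_le_of_ne h'.2 h1⟩).1 h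
    · exact lt_of_le_of_ne (hx.trans h.1) (Ne.symm h0)
    · exact h.2.trans hy.le
  rw [volume_eq_smul_haarAddCircle, Measure.smul_apply, smul_eq_mul] at hvol
  have h := congrArg ENNReal.toReal hvol
  rw [ENNReal.toReal_mul, ENNReal.toReal_ofReal hT0.le, ENNReal.toReal_ofReal (by linarith)] at h
  rw [measureReal_def, eq_div_iff hT0.ne', mul_comm, h]

theorem haarAddCircle_frontier_image_Icc :
    haarAddCircle (frontier (((↑) : ℝ → AddCircle T) '' Icc x y)) = 0 := by
  have hT0 := hT.out
  refine measure_mono_null frontier_image_Icc_subset ?_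
  have hsingle : ∀ z : AddCircle T, (volume : Measure (AddCircle T)) {z} = 0 := fun z => by
    rw [← Metric.closedBall_zero, volume_closedBall]
    simp [hT0.le]
  have h : (volume : Measure (AddCircle T)) {(x : AddCircle T), (y : AddCircle T)} = 0 :=
    measure_union_null (hsingle _) (hsingle _)
  rw [volume_eq_smul_haarAddCircle, Measure.smul_apply, smul_eq_mul, mul_eq_zero] at h
  exact h.resolve_left (ENNReal.ofReal_pos.2 hT0).ne'

end Arc

end AddCircle

/-! ### Equidistribution of orientations -/

namespace PlaneTiling

variable {ι : Type*}

theorem Tile.fourier_angle (T : Tile ι) (k : ℤ) :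
    fourier k (T.angle : AddCircle (2 * Real.pi)) = T.direction ^ k := by
  rw [fourier_coe_apply, ← T.exp_angle, ← Complex.exp_int_mul]
  congr 1
  have := Real.pi_ne_zero
  push_cast
  field_simp

/-- Weyl's criterion for orientations of tiles. -/
theorem uniformlyDistributedAlong_of_tendsto {N : Set ℕ} {s : ℕ → Tile ι}
    (h : ∀ k : ℤ, k ≠ 0 →
      Tendsto (fun n : ℕ => (∑ j ∈ Finset.range n, (s j).direction ^ k) / n) (atTop ⊓ 𝓟 N)
        (𝓝 0)) : UniformlyDistributedAlong N s := by
  classical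
  intro x y hx hxy hy
  have : Fact (0 < 2 * Real.pi) := ⟨Real.two_pi_pos⟩
  have hw := AddCircle.tendsto_frequency_of_tendsto_mean_fourier (T := 2 * Real.pi)
    (l := atTop ⊓ 𝓟 N) inf_le_left (x := fun j => ((s j).angle : AddCircle (2 * Real.pi)))
    (by simpa only [Tile.fourier_angle] using h)
    (AddCircle.isClosed_image_Icc (x := x) (y := y)).measurableSet
    AddCircle.haarAddCircle_frontier_image_Icc
  rw [AddCircle.haarAddCircle_real_image_Icc hx hxy.le hy] at hw
  refine hw.congr fun n => ?_
  rw [angleFrequency]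
  congr 3
  ext j
  simp only [Finset.mem_filter, AddCircle.coe_mem_image_Icc_iff hx hy (s j).angle_mem_Ico]

/-- For a primitive self-similar substitution with a pinwheel-like tiling, all tilings in the tiling
space have statistical circular symmetry. -/
theorem Substitution.IsSelfSimilar.hasStatisticalCircularSymmetry [Fintype ι] [DecidableEq ι]
    {σ : Substitution ι} (hσ : σ.IsSelfSimilar) (hprim : σ.matrix.IsPrimitive)
    {𝒯 : Set (Tile ι)} (h𝒯 : 𝒯 ∈ σ.tilingSpace) (hpin : IsPinwheelLike 𝒯)
    {𝒯' : Set (Tile ι)} (h𝒯' : 𝒯' ∈ σ.tilingSpace) : σ.HasStatisticalCircularSymmetry 𝒯' where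
  along_supertiles s hs := uniformlyDistributedAlong_of_tendsto fun k hk =>
    hσ.tendsto_mean_along_supertiles (f := fun T => T.direction ^ k)
      (fun _ hε => hσ.exists_norm_sum_level_le hprim h𝒯 hpin hk hε) (injOn_univ.1 hs.1.injOn)
  by_distance s hs := uniformlyDistributedAlong_of_tendsto fun k hk => by
    rw [principal_univ, inf_top_eq]
    exact hσ.tendsto_mean_by_distance hprim (f := fun T => T.direction ^ k) (by simp)
      (fun _ hε => hσ.exists_norm_sum_level_le hprim h𝒯 hpin hk hε) h𝒯' hs

end PlaneTiling

end

theorem theorem6p1 {ι : Type*} [Fintype ι] [DecidableEq ι] (σ : PlaneTiling.Substitution ι)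
    (hself : σ.IsSelfSimilar) (hprim : σ.matrix.IsPrimitive)
    (𝒯 : Set (PlaneTiling.Tile ι)) (h𝒯 : 𝒯 ∈ σ.tilingSpace)
    (hpin : PlaneTiling.IsPinwheelLike 𝒯) :
    σ.HasStatisticalCircularSymmetry 𝒯 ∧
      ∀ 𝒯' ∈ σ.tilingSpace, σ.HasStatisticalCircularSymmetry 𝒯' :=
  ⟨hself.hasStatisticalCircularSymmetry hprim h𝒯 hpin h𝒯,
    fun _ h𝒯' => hself.hasStatisticalCircularSymmetry hprim h𝒯 hpin h𝒯'⟩
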